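/- Consider a single-server first-in-first-out queue, initially empty, with i.i.d. nonnegative service times $S_1,S_2,\dots$ of mean $1/\mu$, $0<\mu<\infty$. Time is either continuous (all times are real) or discrete (all times, in particular the service times, are integers). Packet $i$ arrives at $a_i$, starts to be served at $b_i$ and departs at $d_i$, where $b_1=a_1$, $b_i=\max\{d_{i-1},a_i\}$ for $i\ge 2$, and $d_i=b_i+S_i$. A weak-feedback $(n,M,T,\epsilon)$-code consists of arrival times $0\le a_1\le\dots\le a_n$ that are (measurable) functions $a_i=a_i(u,b_1,\dots,b_{i-1})$ of the message $u\in\{1,\dots,M\}$ and of the past service starts, and that are causal (whether $a_i=t$ depends, apart from $u$, only on those $b_k$ with $b_k<t$), together with a decoder $\hat u=\hat u(d_1,\dots,d_n)$ such that, for $u$ uniformly distributed and independent of the service times, $\mathbb{E}[d_n]\le T$ and $\mathbb{P}(\hat u\neq u)\le\epsilon$. For $\lambda>0$, the weak-feedback capacity at output rate $\lambda$, $C_{WF}(\lambda)\in[0,\infty]$, is the supremum of the numbers $R\ge 0$ such that for every $\gamma>0$ there is a sequence of weak-feedback $(n,M,n/\lambda,\epsilon)$-codes with $n\to\infty$, $\epsilon\to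 0$ and $$\lambda\,\frac{\log_2 M}{n}>R-\gamma .$$ Theorem. In both the continuous-time and the discrete-time model, for every $0<\lambda<\mu$, $$C_{WF}(\lambda)\ \le\ \lambda\ \sup_{X:\ \mathbb{E}[(X-S_1)^+]\le \frac1\lambda-\frac1\mu} I\big((X-S_1)^+;\,(X-S_1)^++S_2\big),$$ where $S_1,S_2$ are independent and follow the service time distribution, and $X$ ranges over all real random variables (integer-valued in the discrete-time model) independent of $(S_1,S_2)$. Mutual information is in bits, and both sides may be $+\infty$. -/

import Mathlib

open MeasureTheory Filter
open scoped ENNReal NNReal Topology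

noncomputable section

namespace TimingChannel

/-- The two settings for time. -/
inductive TimeModel where
  | continuous
  | discrete

/-- The admissible time values: all reals in continuous time, the integers in discrete time. -/
def TimeModel.instants : TimeModel → Set ℝ
  | .continuous => Set.univ
  | .discrete => Set.range (fun z : ℤ => (z : ℝ))

/-- `ν` is the law of a service time of rate `μ`: nonnegative, with values in the time set,
and of mean `1 / μ`. -/
structure IsServiceLaw (𝕋 : TimeModel) (μ : ℝ) (ν : Measure ℝ) : Prop where
  nonneg : ∀ᵐ x ∂ν, 0 ≤ x
  mem_instants : ∀ᵐ x ∂ν, x ∈ 𝕋.instants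
  mean_eq : ∫⁻ x, ENNReal.ofReal x ∂ν = ENNReal.ofReal (1 / μ)

/-! ### The single-server FIFO queue driven with weak feedback

Packets are numbered `0, 1, 2, …`. A strategy `f` gives the arrival time of packet `i` as a
function of the instants at which packets `0, …, i - 1` started to be served; `s i` is the
service time of packet `i`. The queue is initially empty. -/

/-- `start f s i` is the instant at which packet `i` starts to be served: the first packet is
served on arrival, and packet `i + 1` is served at the later of its own arrival and the departure
`start f s i + s i` of packet `i`. -/
def start (f : (i : ℕ) → (Fin i → ℝ) → ℝ) (s : ℕ → ℝ) : ℕ → ℝ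
  | 0 => f 0 (fun k => k.elim0)
  | i + 1 => max (start f s i + s i) (f (i + 1) (fun k : Fin (i + 1) => start f s k))
decreasing_by
  · exact Nat.lt_succ_self i
  · exact k.2

/-- Arrival time of packet `i`. -/
def arrival (f : (i : ℕ) → (Fin i → ℝ) → ℝ) (s : ℕ → ℝ) (i : ℕ) : ℝ :=
  f i (fun k : Fin i => start f s k)

/-- Departure time of packet `i`. -/
def departure (f : (i : ℕ) → (Fin i → ℝ) → ℝ) (s : ℕ → ℝ) (i : ℕ) : ℝ :=
  start f s i + s i

/-- The possible realizations of the sequence of service times. -/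
def IsServiceSeq (𝕋 : TimeModel) (s : ℕ → ℝ) : Prop :=
  ∀ i, 0 ≤ s i ∧ s i ∈ 𝕋.instants

/-- A weak-feedback code with `n` packets and `M` messages. Only `enc u i` with `i < n` matters.
There is no such code with `M = 0`, because of the decoder. -/
structure WeakFeedbackCode (𝕋 : TimeModel) (n M : ℕ) where
  /-- arrival time of packet `i` for message `u`, given the earlier starts of service -/
  enc : Fin M → (i : ℕ) → (Fin i → ℝ) → ℝ
  /-- message estimate from the `n` departure times -/
  dec : (Fin n → ℝ) → Fin M
  n_pos : 0 < n
  measurable_enc : ∀ u, ∀ i < n, Measurable (enc u i)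
  measurable_dec : Measurable dec
  arrival_mem : ∀ u s, IsServiceSeq 𝕋 s → ∀ i < n, arrival (enc u) s i ∈ 𝕋.instants
  arrival_nonneg : ∀ u s, IsServiceSeq 𝕋 s → ∀ i < n, 0 ≤ arrival (enc u) s i
  arrival_mono : ∀ u s, IsServiceSeq 𝕋 s → ∀ i j, i ≤ j → j < n →
    arrival (enc u) s i ≤ arrival (enc u) s j
  /-- Causality: whether packet `i` arrives at time `t` depends on the feedback only through the
  starts of service that happened before `t`. If two realizations agree in this respect for `t`
  the arrival time of packet `i` in the first one, then the packet arrives at `t` in both. -/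
  causal : ∀ u s s', IsServiceSeq 𝕋 s → IsServiceSeq 𝕋 s' → ∀ i < n,
    (∀ k < i, (start (enc u) s k < arrival (enc u) s i ∨
        start (enc u) s' k < arrival (enc u) s i) →
      start (enc u) s k = start (enc u) s' k) →
    arrival (enc u) s' i = arrival (enc u) s i

/-- The law of the sequence of i.i.d. service times. -/
def serviceProcess (ν : Measure ℝ) [IsProbabilityMeasure ν] : Measure (ℕ → ℝ) :=
  Measure.infinitePi (fun _ : ℕ => ν)

namespace WeakFeedbackCode

variable {𝕋 : TimeModel} {n M : ℕ}

/-- Expected time of the last departure, over equiprobable messages and the service times. -/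
def meanLastDeparture (c : WeakFeedbackCode 𝕋 n M) (ν : Measure ℝ) [IsProbabilityMeasure ν] :
    ℝ≥0∞ :=
  (∑ u : Fin M, ∫⁻ s, ENNReal.ofReal (departure (c.enc u) s (n - 1)) ∂(serviceProcess ν)) / M

/-- Average decoding error probability, over equiprobable messages and the service times. -/
def errorProb (c : WeakFeedbackCode 𝕋 n M) (ν : Measure ℝ) [IsProbabilityMeasure ν] : ℝ≥0∞ :=
  (∑ u : Fin M, serviceProcess ν
    {s | c.dec (fun i : Fin n => departure (c.enc u) s i) ≠ u}) / M

/-- `c` is an `(n, M, T, ε)`-code for the queue with service law `ν`. -/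
def IsCode (c : WeakFeedbackCode 𝕋 n M) (ν : Measure ℝ) [IsProbabilityMeasure ν]
    (T : ℝ) (ε : ℝ≥0∞) : Prop :=
  c.meanLastDeparture ν ≤ ENNReal.ofReal T ∧ c.errorProb ν ≤ ε

end WeakFeedbackCode

/-- The rate `R` (in bits per unit of time) is achievable with weak feedback at output rate
`lam`: for every `γ > 0` there is a sequence of `(n, M, n / lam, ε)`-codes, with `n → ∞` and
`ε → 0`, such that `lam * log₂ M / n > R - γ`. -/
def IsAchievable (𝕋 : TimeModel) (ν : Measure ℝ) [IsProbabilityMeasure ν] (lam R : ℝ) : Prop :=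
  ∀ γ : ℝ, 0 < γ → ∃ (n M : ℕ → ℕ) (ε : ℕ → ℝ≥0∞) (c : ∀ k, WeakFeedbackCode 𝕋 (n k) (M k)),
    Tendsto n atTop atTop ∧ Tendsto ε atTop (𝓝 0) ∧
    ∀ k, (c k).IsCode ν (n k / lam) (ε k) ∧ lam * (Real.logb 2 (M k) / n k) > R - γ

/-- The weak-feedback capacity at output rate `lam`, possibly infinite. -/
def weakFeedbackCapacity (𝕋 : TimeModel) (ν : Measure ℝ) [IsProbabilityMeasure ν] (lam : ℝ) :
    ℝ≥0∞ :=
  ⨆ (R : ℝ≥0) (_ : IsAchievable 𝕋 ν lam R), (R : ℝ≥0∞)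

/-- Mutual information in bits: the relative entropy of the joint law with respect to the product
of the marginal laws. -/
def mutualInfo {Ω : Type*} [MeasurableSpace Ω] (P : Measure Ω) (U V : Ω → ℝ) : ℝ≥0∞ :=
  InformationTheory.klDiv (P.map (fun ω => (U ω, V ω))) ((P.map U).prod (P.map V)) /
    ENNReal.ofReal (Real.log 2)

/-- The supremum of `I(W; W + S₂)` with `W = (X - S₁)⁺` and `𝔼[W] ≤ a`, over all random variables
`X` with values in the time set that are independent of the independent service times `S₁`, `S₂`
of law `ν`. A point of the probability space is a triple `(X, S₁, S₂)`, and the supremum runs over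
the law `ρ` of `X`. -/
def infoSup (𝕋 : TimeModel) (ν : Measure ℝ) (a : ℝ) : ℝ≥0∞ :=
  ⨆ (ρ : Measure ℝ) (_ : IsProbabilityMeasure ρ) (_ : ∀ᵐ x ∂ρ, x ∈ 𝕋.instants)
    (_ : ∫⁻ ω, ENNReal.ofReal (max (ω.1 - ω.2.1) 0) ∂(ρ.prod (ν.prod ν)) ≤ ENNReal.ofReal a),
    mutualInfo (ρ.prod (ν.prod ν)) (fun ω => max (ω.1 - ω.2.1) 0)
      (fun ω => max (ω.1 - ω.2.1) 0 + ω.2.2)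

end TimingChannel

end

/-!
Between the departure of packet `i - 1` and the start of service of packet `i` the server is idle
during `W = (X - S_{i-1})⁺`, where `X` (here `lead`) is the time from the start of service of packet
`i - 1` to the arrival of packet `i`. Under weak feedback `X` is a function of the message and of the
service times before `S_{i-1}`, so it is independent of the pair `(S_{i-1}, S_i)`, and the next
departure comes `W + S_i` later. Hence every packet but the first is one use of the additive-noise
channel `w ↦ w + S` with an input of the kind over which the information supremum ranges
(`map_idle_eq_jointLaw`).

The converse compares the law of the departures given the message with a law in which the
interdeparture times are independent of each other and of the message, those after the first
departure being i.i.d. of law `Q`. The log-likelihood ratio is a sum of one-packet terms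
`g (W, W + S)` (`lintegral_mul_exp_neg_logRatio_le`), and its mean, averaged over the messages,
bounds `(1 - ε) log M` up to a constant (`log_mul_sum_correct_le`). Let `ρ` be the average over packets
and messages of the laws of `X` (`leadMixture`), and let `Q` be the law of the output when `X` follows
`ρ`. Then the one-packet terms have average at most `I(W; W + S)` under `ρ`, in nats
(`exists_logLikelihood`). The law `ρ` is admissible in the supremum because the busy time `n / μ` and
the idle time have total mean at most `n / lam` (`sum_lintegral_idle_le`). Taking one mixture for the
whole block does away with the concavity of the supremum as a function of the mean constraint.

The first packet is different. Its arrival time `w` is a function of the message alone, so it is not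
of the form `(X - S)⁺`; it gets the value `X = 0` in the mixture. Its contribution has to be shown to
be sublinear in `n`, which is false when the supremum is infinite (a deterministic service time in
continuous time). If the supremum is finite, there is one finite measure against which the
log-likelihood ratio of `w + S` is `log (1 + w²)` plus an integrable term not depending on `w`
(`exists_firstDepartureLaw`). In discrete time this is a weighted sum of the integer translates of
the service law. In continuous time, finiteness of the supremum provides a random input `r` with a
bounded density and a finite mean log-likelihood ratio; the translates by `w - r`, with `r` averaged
out, give the measure.
-/

open MeasureTheory Filter
open scoped ENNReal NNReal Topology
noncomputable section
namespace TimingChannel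

open ProbabilityTheory

/-! ### Likelihood ratios of the additive-noise channel -/

/-- The channel `w ↦ w + S` with additive noise `S` of law `ν`. -/
def additiveNoise (ν : Measure ℝ) [IsProbabilityMeasure ν] : Kernel ℝ ℝ :=
  (Kernel.id ×ₖ Kernel.const ℝ ν).map (fun p : ℝ × ℝ => p.1 + p.2)

instance (ν : Measure ℝ) [IsProbabilityMeasure ν] : IsMarkovKernel (additiveNoise ν) :=
  Kernel.IsMarkovKernel.map _ (by fun_prop)

theorem lintegral_additiveNoise (ν : Measure ℝ) [IsProbabilityMeasure ν] (w : ℝ) {h : ℝ → ℝ≥0∞}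
    (hh : Measurable h) : ∫⁻ y, h y ∂(additiveNoise ν w) = ∫⁻ s, h (w + s) ∂ν := by
  rw [additiveNoise, Kernel.lintegral_map _ (by fun_prop) _ hh,
    Kernel.lintegral_prod _ _ _ (by fun_prop)]
  simp only [Kernel.id_apply, Kernel.const_apply]
  rw [lintegral_dirac' _ (by fun_prop)]

/-- One use of the channel `w ↦ w + S` with input law `PW`. -/
theorem map_eq_compProd_additiveNoise (PW ν : Measure ℝ) [IsProbabilityMeasure PW]
    [IsProbabilityMeasure ν] :
    (PW.prod ν).map (fun p : ℝ × ℝ => (p.1, p.1 + p.2)) = PW.compProd (additiveNoise ν) := by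
  refine Measure.ext_of_lintegral _ fun F hF => ?_
  rw [lintegral_map hF (by fun_prop), lintegral_prod _ (by fun_prop),
    Measure.lintegral_compProd hF]
  refine lintegral_congr fun w => ?_
  rw [lintegral_additiveNoise ν w (by fun_prop)]

/-- If the joint law `J` of input and output of the channel `w ↦ w + S` has a density with respect
to the product of the input law and a law `Q`, then for almost every input `w` the inverse of the
density, as a function of the output, turns the law of `w + S` into a measure dominated by `Q`.
The null set of excluded inputs does not depend on the test function `h`. -/
theorem ae_lintegral_mul_exp_neg_llr_le {PW ν Q : Measure ℝ} [IsProbabilityMeasure PW]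
    [IsProbabilityMeasure ν] [IsProbabilityMeasure Q] {J : Measure (ℝ × ℝ)}
    (hJ : J = (PW.prod ν).map (fun p : ℝ × ℝ => (p.1, p.1 + p.2)))
    (hac : J ≪ PW.prod Q) :
    ∀ᵐ w ∂PW, ∀ h : ℝ → ℝ≥0∞, Measurable h →
      ∫⁻ s, h (w + s) * ENNReal.ofReal (Real.exp (-llr J (PW.prod Q) (w, w + s))) ∂ν
        ≤ ∫⁻ y, h y ∂Q := by
  have hJp : IsProbabilityMeasure J := by
    rw [hJ]; exact Measure.isProbabilityMeasure_map (by fun_prop)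
  set p := J.rnDeriv (PW.prod Q) with hp
  have htop : ∀ᵐ w ∂PW, ∀ᵐ y ∂Q, p (w, y) < ⊤ :=
    Measure.ae_ae_of_ae_prod (Measure.rnDeriv_lt_top J (PW.prod Q))
  set κ := additiveNoise ν
  set r := fun x : ℝ × ℝ => κ.rnDeriv (Kernel.const ℝ Q) x.1 x.2 with hr
  have hrm : Measurable r := by fun_prop
  rw [map_eq_compProd_additiveNoise] at hJ
  have hker : ∀ᵐ w ∂PW, κ w ≪ Q := by
    have h := hac
    rw [hJ, ← Measure.compProd_const] at h
    simpa using h.kernel_of_compProd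
  have hκ : ∀ᵐ w ∂PW, κ w = (Kernel.const ℝ Q).withDensity (κ.rnDeriv (Kernel.const ℝ Q)) w := by
    filter_upwards [hker] with w hw
    exact (Kernel.withDensity_rnDeriv_eq (by simpa using hw)).symm
  have hJr : J = (PW.prod Q).withDensity r := by
    rw [hJ, ← Measure.compProd_const, Measure.compProd_congr hκ,
      Measure.compProd_withDensity (by fun_prop)]
  have hpr : ∀ᵐ w ∂PW, ∀ᵐ y ∂Q, p (w, y) = r (w, y) := by
    refine Measure.ae_ae_of_ae_prod (p := fun x => p x = r x) ?_
    rw [hp, hJr]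
    exact Measure.rnDeriv_withDensity _ hrm
  filter_upwards [hκ, htop, hpr] with w hw hwt hwp h hh
  set L : ℝ → ℝ≥0∞ := fun y => h y * ENNReal.ofReal (Real.exp (-llr J (PW.prod Q) (w, y)))
  have hL : Measurable L := by
    have := measurable_llr J (PW.prod Q)
    fun_prop
  rw [← lintegral_additiveNoise ν w hL]
  change ∫⁻ y, L y ∂(κ w) ≤ _
  rw [hw, Kernel.withDensity_apply _ (by fun_prop), Kernel.const_apply,
    lintegral_withDensity_eq_lintegral_mul _ (by fun_prop) hL]
  refine lintegral_mono_ae ?_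
  filter_upwards [hwt, hwp] with y hy hyr
  have hyr' : κ.rnDeriv (Kernel.const ℝ Q) w y = p (w, y) := hyr.symm
  simp only [Pi.mul_apply, hyr', L, llr, ← hp]
  rcases eq_or_ne (p (w, y)) 0 with h0 | h0
  · simp [h0]
  have hpos : 0 < (p (w, y)).toReal := ENNReal.toReal_pos h0 hy.ne
  rw [Real.exp_neg, Real.exp_log hpos, ENNReal.ofReal_inv_of_pos hpos, ENNReal.ofReal_toReal hy.ne,
    mul_comm, mul_assoc, ENNReal.inv_mul_cancel h0 hy.ne, mul_one]

/-! ### Resampling one service time -/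

instance (ν : Measure ℝ) [IsProbabilityMeasure ν] : IsProbabilityMeasure (serviceProcess ν) := by
  unfold serviceProcess; infer_instance

@[fun_prop]
theorem measurable_update_prod (k : ℕ) :
    Measurable (fun p : (ℕ → ℝ) × ℝ => Function.update p.1 k p.2) := by
  refine measurable_pi_lambda _ fun i => ?_
  rcases eq_or_ne i k with rfl | h
  · simpa using measurable_snd
  · simpa [h] using! (measurable_pi_apply i).comp measurable_fst

theorem map_update_serviceProcess (ν : Measure ℝ) [IsProbabilityMeasure ν] (k : ℕ) :
    ((serviceProcess ν).prod ν).map (fun p => Function.update p.1 k p.2) = serviceProcess ν := by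
  refine Measure.eq_infinitePi _ fun A t ht => ?_
  have hbox : MeasurableSet ((A : Set ℕ).pi t) :=
    MeasurableSet.pi A.countable_toSet fun i _ => ht i
  rw [Measure.map_apply (measurable_update_prod k) hbox]
  by_cases hk : k ∈ A
  · have : (fun p : (ℕ → ℝ) × ℝ => Function.update p.1 k p.2) ⁻¹' ((A : Set ℕ).pi t)
        = ((A.erase k : Finset ℕ) : Set ℕ).pi t ×ˢ t k := by
      ext ⟨s, x⟩
      simp only [Set.mem_preimage, Set.mem_pi, Finset.mem_coe, Set.mem_prod, Finset.mem_erase]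
      constructor
      · intro h
        refine ⟨fun i hi => ?_, ?_⟩
        · simpa [hi.1] using h i hi.2
        · simpa using h k hk
      · rintro ⟨h1, h2⟩ i hi
        rcases eq_or_ne i k with rfl | hik
        · simpa using h2
        · simpa [hik] using h1 i ⟨hik, hi⟩
    rw [this, Measure.prod_prod, serviceProcess, Measure.infinitePi_pi _ fun i _ => ht i,
      Finset.prod_erase_mul _ _ hk]
  · have : (fun p : (ℕ → ℝ) × ℝ => Function.update p.1 k p.2) ⁻¹' ((A : Set ℕ).pi t)
        = (A : Set ℕ).pi t ×ˢ Set.univ := by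
      ext ⟨s, x⟩
      simp only [Set.mem_preimage, Set.mem_pi, Finset.mem_coe, Set.mem_prod, Set.mem_univ,
        and_true]
      refine forall₂_congr fun i hi => ?_
      rw [Function.update_of_ne (by rintro rfl; exact hk hi)]
    rw [this, Measure.prod_prod, serviceProcess, Measure.infinitePi_pi _ fun i _ => ht i,
      measure_univ, mul_one]

/-- Replacing one of the i.i.d. service times by a fresh copy does not change expectations. -/
theorem lintegral_serviceProcess_update (ν : Measure ℝ) [IsProbabilityMeasure ν] (k : ℕ)
    {F : (ℕ → ℝ) → ℝ≥0∞} (hF : Measurable F) :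
    ∫⁻ s, F s ∂(serviceProcess ν)
      = ∫⁻ s, ∫⁻ t, F (Function.update s k t) ∂ν ∂(serviceProcess ν) := by
  conv_lhs => rw [← map_update_serviceProcess ν k]
  rw [lintegral_map hF (measurable_update_prod k), lintegral_prod _ (by fun_prop)]

theorem map_eval_serviceProcess (ν : Measure ℝ) [IsProbabilityMeasure ν] (i : ℕ) :
    (serviceProcess ν).map (fun s => s i) = ν :=
  Measure.infinitePi_map_eval _ i

theorem ae_isServiceSeq {𝕋 : TimeModel} {μ : ℝ} {ν : Measure ℝ} [IsProbabilityMeasure ν]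
    (hν : IsServiceLaw 𝕋 μ ν) : ∀ᵐ s ∂(serviceProcess ν), IsServiceSeq 𝕋 s := by
  refine ae_all_iff.2 fun i => ?_
  have h := hν.nonneg.and hν.mem_instants
  rw [← map_eval_serviceProcess ν i] at h
  exact ae_of_ae_map (measurable_pi_apply i).aemeasurable h

/-! ### Idle periods of the queue -/

section Queue

variable (f : (i : ℕ) → (Fin i → ℝ) → ℝ)

/-- The time from the previous start of service to the arrival of packet `i`, which does not depend
on the service times of packets `i - 1, i, …`. For the first packet it is set to `0`. -/
def lead (s : ℕ → ℝ) : ℕ → ℝ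
  | 0 => 0
  | i + 1 => arrival f s (i + 1) - start f s i

/-- The idle time of the server between the departure of packet `i - 1` and the start of service
of packet `i`. For the first packet it is set to `0`. -/
def idle (s : ℕ → ℝ) : ℕ → ℝ
  | 0 => 0
  | i + 1 => max (lead f s (i + 1) - s i) 0

theorem start_zero (s : ℕ → ℝ) : start f s 0 = arrival f s 0 := by
  rw [start, arrival]; congr 1; ext k; exact k.elim0

theorem arrival_zero (s s' : ℕ → ℝ) : arrival f s 0 = arrival f s' 0 := by
  rw [arrival, arrival]; congr 1; ext k; exact k.elim0

theorem start_succ (s : ℕ → ℝ) (i : ℕ) :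
    start f s (i + 1) = start f s i + s i + idle f s (i + 1) := by
  rw [start, idle, lead, arrival, ← max_add_add_left, max_comm (start f s i + s i)]
  congr 1 <;> ring

theorem departure_succ (s : ℕ → ℝ) (i : ℕ) :
    departure f s (i + 1) = departure f s i + (idle f s (i + 1) + s (i + 1)) := by
  rw [departure, departure, start_succ, add_assoc]

theorem departure_zero (s : ℕ → ℝ) : departure f s 0 = arrival f s 0 + s 0 := by
  rw [departure, start_zero]

theorem idle_nonneg (s : ℕ → ℝ) (i : ℕ) : 0 ≤ idle f s i := by
  cases i <;> simp [idle]

theorem start_update (s : ℕ → ℝ) (k : ℕ) (t : ℝ) (i : ℕ) (hi : i ≤ k) :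
    start f (Function.update s k t) i = start f s i := by
  induction i using Nat.strong_induction_on with
  | _ i ih =>
    cases i with
    | zero => rw [start_zero, start_zero]; exact arrival_zero f _ _
    | succ i =>
      rw [start, start, ih i (Nat.lt_succ_self i) (by omega), Function.update_of_ne (by omega)]
      congr 2
      ext j
      exact ih j j.2 (by omega)

theorem arrival_update (s : ℕ → ℝ) (k : ℕ) (t : ℝ) (i : ℕ) (hi : i ≤ k + 1) :
    arrival f (Function.update s k t) i = arrival f s i := by
  rw [arrival, arrival]
  congr 1
  ext j
  exact start_update f s k t j (by omega)

theorem lead_update (s : ℕ → ℝ) (k : ℕ) (t : ℝ) (i : ℕ) (hi : i ≤ k + 1) :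
    lead f (Function.update s k t) i = lead f s i := by
  cases i with
  | zero => rfl
  | succ i => rw [lead, lead, arrival_update f s k t _ hi, start_update f s k t _ (by omega)]

theorem idle_update (s : ℕ → ℝ) (k : ℕ) (t : ℝ) (i : ℕ) (hi : i ≤ k) :
    idle f (Function.update s k t) i = idle f s i := by
  cases i with
  | zero => rfl
  | succ i =>
    rw [idle, idle, lead_update f s k t _ (by omega), Function.update_of_ne (by omega)]

theorem departure_update (s : ℕ → ℝ) (k : ℕ) (t : ℝ) (i : ℕ) (hi : i < k) :
    departure f (Function.update s k t) i = departure f s i := by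
  rw [departure, departure, start_update f s k t _ hi.le, Function.update_of_ne (by omega)]

end Queue

theorem measurable_start {f : (i : ℕ) → (Fin i → ℝ) → ℝ} {n : ℕ}
    (hf : ∀ i < n, Measurable (f i)) (i : ℕ) (hi : i < n) :
    Measurable (fun s => start f s i) := by
  induction i using Nat.strong_induction_on with
  | _ i ih =>
    cases i with
    | zero => simp only [start]; exact measurable_const
    | succ i =>
      simp only [start]
      have h1 := ih i (Nat.lt_succ_self i) (by omega)
      exact (h1.add (measurable_pi_apply i)).max
        ((hf _ hi).comp (measurable_pi_lambda _ fun j => ih j j.2 (by omega)))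

theorem measurable_arrival {f : (i : ℕ) → (Fin i → ℝ) → ℝ} {n : ℕ}
    (hf : ∀ i < n, Measurable (f i)) (i : ℕ) (hi : i < n) :
    Measurable (fun s => arrival f s i) :=
  (hf i hi).comp (measurable_pi_lambda _ fun j => measurable_start hf j (by omega))

theorem measurable_departure {f : (i : ℕ) → (Fin i → ℝ) → ℝ} {n : ℕ}
    (hf : ∀ i < n, Measurable (f i)) (i : ℕ) (hi : i < n) :
    Measurable (fun s => departure f s i) :=
  (measurable_start hf i hi).add (measurable_pi_apply i)

theorem measurable_lead {f : (i : ℕ) → (Fin i → ℝ) → ℝ} {n : ℕ}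
    (hf : ∀ i < n, Measurable (f i)) (i : ℕ) (hi : i < n) :
    Measurable (fun s => lead f s i) := by
  cases i with
  | zero => exact measurable_const
  | succ i => exact (measurable_arrival hf _ hi).sub (measurable_start hf i (by omega))

theorem measurable_idle {f : (i : ℕ) → (Fin i → ℝ) → ℝ} {n : ℕ}
    (hf : ∀ i < n, Measurable (f i)) (i : ℕ) (hi : i < n) :
    Measurable (fun s => idle f s i) := by
  cases i with
  | zero => exact measurable_const
  | succ i =>
    exact ((measurable_lead hf _ hi).sub (measurable_pi_apply i)).max measurable_const

/-! ### The law of an idle period and of the time to the next departure -/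

/-- The law of `W = (X - S₁)⁺`, for `X` of law `ρ` and `S₁` of law `ν`. -/
def idleLaw (ρ ν : Measure ℝ) : Measure ℝ :=
  (ρ.prod ν).map (fun p => max (p.1 - p.2) 0)

/-- The joint law of `(W, W + S₂)`, for `W = (X - S₁)⁺` with `X` of law `ρ` and `S₁`, `S₂` of
law `ν`. -/
def jointLaw (ρ ν : Measure ℝ) : Measure (ℝ × ℝ) :=
  (ρ.prod (ν.prod ν)).map
    (fun ω => (max (ω.1 - ω.2.1) 0, max (ω.1 - ω.2.1) 0 + ω.2.2))

instance (ρ ν : Measure ℝ) [IsProbabilityMeasure ρ] [IsProbabilityMeasure ν] :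
    IsProbabilityMeasure (idleLaw ρ ν) :=
  Measure.isProbabilityMeasure_map (by fun_prop)

instance (ρ ν : Measure ℝ) [IsProbabilityMeasure ρ] [IsProbabilityMeasure ν] :
    IsProbabilityMeasure (jointLaw ρ ν) :=
  Measure.isProbabilityMeasure_map (by fun_prop)

theorem lintegral_idleLaw (ρ ν : Measure ℝ) [SFinite ρ] [SFinite ν] {F : ℝ → ℝ≥0∞}
    (hF : Measurable F) :
    ∫⁻ w, F w ∂(idleLaw ρ ν) = ∫⁻ x, ∫⁻ s, F (max (x - s) 0) ∂ν ∂ρ := by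
  rw [idleLaw, lintegral_map hF (by fun_prop), lintegral_prod _ (by fun_prop)]

theorem lintegral_jointLaw (ρ ν : Measure ℝ) [SFinite ρ] [SFinite ν] {F : ℝ × ℝ → ℝ≥0∞}
    (hF : Measurable F) :
    ∫⁻ p, F p ∂(jointLaw ρ ν)
      = ∫⁻ x, ∫⁻ s, ∫⁻ t, F (max (x - s) 0, max (x - s) 0 + t) ∂ν ∂ν ∂ρ := by
  rw [jointLaw, lintegral_map hF (by fun_prop), lintegral_prod _ (by fun_prop)]
  refine lintegral_congr fun x => ?_
  rw [lintegral_prod _ (by fun_prop)]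

theorem jointLaw_eq_map (ρ ν : Measure ℝ) [SFinite ρ] [SFinite ν] :
    jointLaw ρ ν = ((idleLaw ρ ν).prod ν).map (fun p : ℝ × ℝ => (p.1, p.1 + p.2)) := by
  have : SFinite (idleLaw ρ ν) := by unfold idleLaw; infer_instance
  refine Measure.ext_of_lintegral _ fun F hF => ?_
  rw [lintegral_jointLaw ρ ν hF, lintegral_map hF (by fun_prop), lintegral_prod _ (by fun_prop),
    lintegral_idleLaw ρ ν (by fun_prop)]

theorem map_fst_jointLaw (ρ ν : Measure ℝ) [SFinite ρ] [IsProbabilityMeasure ν] :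
    (jointLaw ρ ν).map Prod.fst = idleLaw ρ ν := by
  refine Measure.ext_of_lintegral _ fun F hF => ?_
  rw [lintegral_map hF measurable_fst, lintegral_jointLaw ρ ν (by fun_prop),
    lintegral_idleLaw ρ ν hF]
  simp

theorem map_sub_max_eq_idleLaw (ρ ν : Measure ℝ) [SFinite ρ] [IsProbabilityMeasure ν] :
    (ρ.prod (ν.prod ν)).map (fun ω => max (ω.1 - ω.2.1) 0) = idleLaw ρ ν := by
  rw [← map_fst_jointLaw, jointLaw, Measure.map_map measurable_fst (by fun_prop)]
  rfl

/-- The joint law depends linearly on the law of `X`. -/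
theorem jointLaw_smul_sum {ι : Type*} (T : Finset ι) (a : ℝ≥0∞) (ρ : ι → Measure ℝ)
    [∀ x, IsProbabilityMeasure (ρ x)] (ν : Measure ℝ) [IsProbabilityMeasure ν]
    [SFinite (a • ∑ x ∈ T, ρ x)] :
    jointLaw (a • ∑ x ∈ T, ρ x) ν = a • ∑ x ∈ T, jointLaw (ρ x) ν := by
  refine Measure.ext_of_lintegral _ fun F hF => ?_
  rw [lintegral_jointLaw _ ν hF, lintegral_smul_measure, lintegral_smul_measure,
    lintegral_finsetSum_measure, lintegral_finsetSum_measure]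
  simp_rw [lintegral_jointLaw _ ν hF]

/-- In the queue, `lead` is independent of the next two service times, so that the idle time and
the time to the next departure are jointly distributed like `W` and `W + S₂` with `W = (X - S₁)⁺`,
where `X` follows the law of `lead`. -/
theorem map_idle_eq_jointLaw {𝕋 : TimeModel} {μ : ℝ} {ν : Measure ℝ} [IsProbabilityMeasure ν]
    (hν : IsServiceLaw 𝕋 μ ν) {f : (i : ℕ) → (Fin i → ℝ) → ℝ} {n : ℕ}
    (hf : ∀ i < n, Measurable (f i)) (i : ℕ) (hi : i < n) :
    (serviceProcess ν).map (fun s => (idle f s i, idle f s i + s i))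
      = jointLaw ((serviceProcess ν).map (fun s => lead f s i)) ν := by
  have hidle := measurable_idle hf i hi
  have hlead := measurable_lead hf i hi
  have hpair : Measurable fun s : ℕ → ℝ => (idle f s i, idle f s i + s i) :=
    hidle.prodMk (hidle.add (measurable_pi_apply i))
  refine Measure.ext_of_lintegral _ fun F hF => ?_
  rw [lintegral_map hF hpair, lintegral_jointLaw _ ν hF, lintegral_map (by fun_prop) hlead,
    lintegral_serviceProcess_update ν i (F := fun s => F (idle f s i, idle f s i + s i)) (by fun_prop)]
  cases i with
  | zero =>
    refine lintegral_congr fun s => ?_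
    have : ∀ᵐ x ∂ν, ∫⁻ t, F (max (lead f s 0 - x) 0, max (lead f s 0 - x) 0 + t) ∂ν
        = ∫⁻ t, F (0, 0 + t) ∂ν := by
      filter_upwards [hν.nonneg] with x hx
      have : max (lead f s 0 - x) 0 = 0 := max_eq_right (by simpa [lead] using hx)
      rw [this]
    rw [lintegral_congr_ae this]
    simp [idle]
  | succ i =>
    have h1 : ∀ s t, F (idle f (Function.update s (i + 1) t) (i + 1),
          idle f (Function.update s (i + 1) t) (i + 1) + Function.update s (i + 1) t (i + 1))
        = F (idle f s (i + 1), idle f s (i + 1) + t) := fun s t => by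
      rw [idle_update f s _ t _ le_rfl, Function.update_self]
    have hm : Measurable fun s => ∫⁻ t, F (idle f s (i + 1), idle f s (i + 1) + t) ∂ν :=
      Measurable.lintegral_prod_right' (f := fun p : (ℕ → ℝ) × ℝ =>
        F (idle f p.1 (i + 1), idle f p.1 (i + 1) + p.2)) (by fun_prop)
    simp_rw [h1]
    rw [lintegral_serviceProcess_update ν i hm]
    simp [idle, lead_update]

/-- A finite mutual information between `W` and `W + S₂` is the mean of a log-likelihood ratio `g`,
and `exp (-g)` turns the conditional law of `W + S₂` given `W = w` into a measure dominated by a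
law `Q` not depending on `w`. -/
theorem exists_logLikelihood (ρ ν : Measure ℝ) [IsProbabilityMeasure ρ] [IsProbabilityMeasure ν]
    (hfin : mutualInfo (ρ.prod (ν.prod ν)) (fun ω => max (ω.1 - ω.2.1) 0)
      (fun ω => max (ω.1 - ω.2.1) 0 + ω.2.2) ≠ ⊤) :
    ∃ (Q : Measure ℝ) (g : ℝ × ℝ → ℝ), IsProbabilityMeasure Q ∧ Measurable g ∧
      Integrable g (jointLaw ρ ν) ∧
      ENNReal.ofReal (∫ p, g p ∂(jointLaw ρ ν)) =
        mutualInfo (ρ.prod (ν.prod ν)) (fun ω => max (ω.1 - ω.2.1) 0)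
          (fun ω => max (ω.1 - ω.2.1) 0 + ω.2.2) * ENNReal.ofReal (Real.log 2) ∧
      ∀ᵐ w ∂(idleLaw ρ ν), ∀ h : ℝ → ℝ≥0∞, Measurable h →
        ∫⁻ s, h (w + s) * ENNReal.ofReal (Real.exp (-g (w, w + s))) ∂ν ≤ ∫⁻ y, h y ∂Q := by
  set Q := (ρ.prod (ν.prod ν)).map (fun ω => max (ω.1 - ω.2.1) 0 + ω.2.2) with hQ
  have hQp : IsProbabilityMeasure Q := Measure.isProbabilityMeasure_map (by fun_prop)
  have hlog : 0 < Real.log 2 := Real.log_pos one_lt_two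
  have hmi : mutualInfo (ρ.prod (ν.prod ν)) (fun ω => max (ω.1 - ω.2.1) 0)
      (fun ω => max (ω.1 - ω.2.1) 0 + ω.2.2) * ENNReal.ofReal (Real.log 2)
      = InformationTheory.klDiv (jointLaw ρ ν) ((idleLaw ρ ν).prod Q) := by
    rw [mutualInfo, map_sub_max_eq_idleLaw,
      ENNReal.div_mul_cancel (by simpa using hlog) ENNReal.ofReal_ne_top]
    rfl
  have hkl : InformationTheory.klDiv (jointLaw ρ ν) ((idleLaw ρ ν).prod Q) ≠ ⊤ := by
    rw [← hmi]; exact ENNReal.mul_ne_top hfin ENNReal.ofReal_ne_top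
  obtain ⟨hac, hint⟩ := InformationTheory.klDiv_ne_top_iff.1 hkl
  refine ⟨Q, llr (jointLaw ρ ν) ((idleLaw ρ ν).prod Q), hQp, measurable_llr _ _, hint, ?_,
    ae_lintegral_mul_exp_neg_llr_le (jointLaw_eq_map ρ ν) hac⟩
  rw [hmi, InformationTheory.klDiv_of_ac_of_integrable hac hint]
  simp

/-! ### A reference law for the first departure -/

theorem summable_inv_one_add_sq_int : Summable fun k : ℤ => (1 + (k : ℝ) ^ 2)⁻¹ := by
  have h : Summable fun k : ℤ => 1 / (k : ℝ) ^ 2 :=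
    Real.summable_one_div_int_pow.2 one_lt_two
  refine Summable.of_norm_bounded_eventually h ?_
  filter_upwards [(Set.finite_singleton (0 : ℤ)).compl_mem_cofinite] with k hk
  have hk : (k : ℝ) ≠ 0 := by exact_mod_cast hk
  rw [Real.norm_of_nonneg (by positivity), one_div]
  gcongr
  linarith

/-- In discrete time a weighted sum of the integer translates of the service law serves as reference
output law for all constant inputs. -/
theorem exists_firstDepartureLaw_discrete (ν : Measure ℝ) [IsProbabilityMeasure ν] :
    ∃ (Q₁ : Measure ℝ), IsFiniteMeasure Q₁ ∧
      ∀ w ∈ TimeModel.discrete.instants, ∀ h : ℝ → ℝ≥0∞, Measurable h →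
        ∫⁻ s, h (w + s) * ENNReal.ofReal ((1 + w ^ 2)⁻¹) ∂ν ≤ ∫⁻ y, h y ∂Q₁ := by
  refine ⟨Measure.sum fun k : ℤ =>
    ENNReal.ofReal ((1 + (k : ℝ) ^ 2)⁻¹) • ν.map (fun s => (k : ℝ) + s), ⟨?_⟩, ?_⟩
  · rw [Measure.sum_apply _ MeasurableSet.univ]
    have : ∀ k : ℤ, (ENNReal.ofReal ((1 + (k : ℝ) ^ 2)⁻¹) • ν.map (fun s => (k : ℝ) + s)) Set.univ
        = ENNReal.ofReal ((1 + (k : ℝ) ^ 2)⁻¹) := fun k => by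
      rw [Measure.smul_apply, Measure.map_apply (by fun_prop) MeasurableSet.univ]
      simp
    simp_rw [this]
    rw [← ENNReal.ofReal_tsum_of_nonneg (fun k => by positivity) summable_inv_one_add_sq_int]
    exact ENNReal.ofReal_lt_top
  · rintro w ⟨k, rfl⟩ h hh
    rw [lintegral_sum_measure]
    refine le_trans (le_of_eq ?_) (ENNReal.le_tsum k)
    rw [lintegral_smul_measure, lintegral_map hh (by fun_prop), lintegral_mul_const _ (by fun_prop),
      mul_comm, smul_eq_mul]

/-- There is a law `ρ` for `X` under which `W = (X - S₁)⁺` has a small mean and, on `W > 0`, a bounded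
density with bounded support: `X` is `0` with high probability, and otherwise uniform. The law `η`
is that of `W` conditioned on `W > 0`. -/
theorem exists_law_with_density {μ : ℝ} (ν : Measure ℝ) [IsProbabilityMeasure ν]
    (hν : IsServiceLaw .continuous μ ν) {a : ℝ} (ha : 0 < a) :
    ∃ (ρ η : Measure ℝ) (B : ℝ) (C : ℝ≥0∞), IsProbabilityMeasure ρ ∧ IsProbabilityMeasure η ∧
      ∫⁻ ω, ENNReal.ofReal (max (ω.1 - ω.2.1) 0) ∂(ρ.prod (ν.prod ν)) ≤ ENNReal.ofReal a ∧
      C ≠ ⊤ ∧ η ≤ C • idleLaw ρ ν ∧ η ≤ C • volume ∧ ∀ᵐ r ∂η, 0 ≤ r ∧ r ≤ B := by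
  obtain ⟨K, hK0, hK⟩ : ∃ K : ℝ, 0 < K ∧ 0 < ν (Set.Iio K) := by
    have hU : (⋃ k : ℕ, Set.Iio ((k : ℝ) + 1)) = Set.univ := by
      refine Set.eq_univ_of_forall fun x => ?_
      obtain ⟨k, hk⟩ := exists_nat_gt x
      exact Set.mem_iUnion.2 ⟨k, by simp only [Set.mem_Iio]; linarith⟩
    by_contra! hcon
    have : ν (⋃ k : ℕ, Set.Iio ((k : ℝ) + 1)) = 0 :=
      measure_iUnion_null fun k => le_antisymm (hcon _ (by positivity)) (zero_le)
    rw [hU, measure_univ] at this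
    exact one_ne_zero this
  -- With probability `δ`, `X` is uniform on `[K, K + 1]`, and then `W > 0` whenever `S₁ < K`;
  -- `δ` is small enough for the mean constraint, since `W ≤ K + 1`.
  set δ : ℝ := min 1 (a / (K + 1)) with hδ
  have hδ0 : 0 < δ := lt_min one_pos (by positivity)
  have hδ1 : δ ≤ 1 := min_le_left _ _
  have hδa : δ * (K + 1) ≤ a := by
    have : δ ≤ a / (K + 1) := min_le_right _ _
    rwa [le_div_iff₀ (by positivity)] at this
  set V : Measure ℝ := volume.restrict (Set.Icc K (K + 1)) with hV
  set ρ : Measure ℝ := ENNReal.ofReal (1 - δ) • Measure.dirac 0 + ENNReal.ofReal δ • V with hρ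
  have hρint : ∀ F : ℝ → ℝ≥0∞, Measurable F → ∫⁻ x, F x ∂ρ
      = ENNReal.ofReal (1 - δ) * F 0 + ENNReal.ofReal δ * ∫⁻ x, F x ∂V := fun F hF => by
    rw [hρ, lintegral_add_measure, lintegral_smul_measure, lintegral_smul_measure,
      lintegral_dirac' _ hF, smul_eq_mul, smul_eq_mul]
  have hρp : IsProbabilityMeasure ρ := by
    refine ⟨?_⟩
    have hVu : V Set.univ = 1 := by simp [hV]
    rw [hρ, Measure.add_apply, Measure.smul_apply, Measure.smul_apply, hVu]
    simp [← ENNReal.ofReal_add (sub_nonneg.2 hδ1) hδ0.le]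
  set η₀ : Measure ℝ := (idleLaw ρ ν).restrict (Set.Ioi 0) with hη₀
  have hη₀int : ∀ F : ℝ → ℝ≥0∞, Measurable F → ∫⁻ r, F r ∂η₀
      = ENNReal.ofReal δ * ∫⁻ x, ∫⁻ s, (Set.Ioi 0).indicator F (max (x - s) 0) ∂ν ∂V := by
    intro F hF
    have hFi : Measurable ((Set.Ioi (0 : ℝ)).indicator F) := hF.indicator measurableSet_Ioi
    rw [hη₀, ← lintegral_indicator measurableSet_Ioi, lintegral_idleLaw ρ ν hFi,
      hρint _ (by fun_prop)]
    have : ∫⁻ s, (Set.Ioi (0 : ℝ)).indicator F (max (0 - s) 0) ∂ν = 0 := by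
      rw [← lintegral_zero (μ := ν)]
      refine lintegral_congr_ae ?_
      filter_upwards [hν.nonneg] with s hs
      rw [max_eq_right (by linarith)]
      simp
    rw [this, mul_zero, zero_add]
  have hη₀vol : η₀ ≤ volume := by
    refine Measure.le_iff.2 fun A hA => ?_
    rw [← lintegral_indicator_one hA, ← lintegral_indicator_one hA,
      hη₀int _ (measurable_one.indicator hA)]
    have hFA : Measurable (A.indicator (1 : ℝ → ℝ≥0∞)) := measurable_one.indicator hA
    calc _ ≤ 1 * ∫⁻ x, ∫⁻ s, A.indicator (1 : ℝ → ℝ≥0∞) (x - s) ∂ν ∂volume := by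
          refine mul_le_mul' (ENNReal.ofReal_le_one.2 hδ1) ?_
          refine (lintegral_mono' Measure.restrict_le_self le_rfl).trans ?_
          refine lintegral_mono fun x => lintegral_mono fun s => ?_
          rcases le_or_gt (x - s) 0 with h | h
          · simp [max_eq_right h]
          · rw [max_eq_left h.le]
            exact Set.indicator_le_self _ _ _
      _ = ∫⁻ s, ∫⁻ x, A.indicator (1 : ℝ → ℝ≥0∞) (x - s) ∂volume ∂ν := by
          rw [one_mul, lintegral_lintegral_swap (by fun_prop)]
      _ = _ := by
          simp_rw [lintegral_sub_right_eq_self (μ := volume) (A.indicator (1 : ℝ → ℝ≥0∞))]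
          simp
  have hη₀B : ∀ᵐ r ∂η₀, 0 ≤ r ∧ r ≤ K + 1 := by
    refine ae_iff.2 ?_
    have hm : MeasurableSet {r : ℝ | ¬ (0 ≤ r ∧ r ≤ K + 1)} := by
      have : {r : ℝ | ¬ (0 ≤ r ∧ r ≤ K + 1)} = (Set.Icc 0 (K + 1))ᶜ := rfl
      rw [this]; measurability
    rw [← lintegral_indicator_one hm, hη₀int _ (measurable_one.indicator hm)]
    have hin : ∀ᵐ x ∂V, ∫⁻ s, (Set.Ioi (0 : ℝ)).indicator
        ({r : ℝ | ¬ (0 ≤ r ∧ r ≤ K + 1)}.indicator (1 : ℝ → ℝ≥0∞)) (max (x - s) 0) ∂ν = 0 := by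
      filter_upwards [ae_restrict_mem measurableSet_Icc] with x hx
      rw [← lintegral_zero (μ := ν)]
      refine lintegral_congr_ae ?_
      filter_upwards [hν.nonneg] with s hs
      refine (Set.indicator_apply_eq_zero).2 fun _ => Set.indicator_of_notMem ?_ _
      simp only [Set.mem_ofPred_eq, not_not]
      exact ⟨le_max_right _ _, max_le (by linarith [hx.2]) (by linarith)⟩
    rw [lintegral_congr_ae hin]
    simp
  -- Otherwise `η₀` could not be normalized.
  have hη₀pos : η₀ Set.univ ≠ 0 := by
    rw [← lintegral_one, hη₀int _ measurable_const]
    have hge : ν (Set.Iio K) ≤ ∫⁻ x, ∫⁻ s, (Set.Ioi (0 : ℝ)).indicator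
        (fun _ => (1 : ℝ≥0∞)) (max (x - s) 0) ∂ν ∂V := by
      calc ν (Set.Iio K) = ∫⁻ x, ν (Set.Iio K) ∂V := by simp [hV]
        _ ≤ _ := by
          refine lintegral_mono_ae ?_
          filter_upwards [ae_restrict_mem measurableSet_Icc] with x hx
          rw [← lintegral_indicator_one measurableSet_Iio]
          refine lintegral_mono fun s => ?_
          by_cases hs : s < K
          · have : 0 < max (x - s) 0 := lt_max_of_lt_left (by linarith [hx.1])
            simp [hs, this]
          · simp [hs]
    exact mul_ne_zero (by simpa using hδ0) (hK.trans_le hge).ne'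
  have hη₀top : η₀ Set.univ ≠ ⊤ := measure_ne_top _ _
  refine ⟨ρ, (η₀ Set.univ)⁻¹ • η₀, K + 1, (η₀ Set.univ)⁻¹, hρp, ⟨?_⟩, ?_,
    ENNReal.inv_ne_top.2 hη₀pos, ?_, ?_, ?_⟩
  · rw [Measure.smul_apply, smul_eq_mul, ENNReal.inv_mul_cancel hη₀pos hη₀top]
  · rw [lintegral_prod _ (by fun_prop), hρint _ (by fun_prop)]
    have h0 : ∫⁻ q : ℝ × ℝ, ENNReal.ofReal (max (0 - q.1) 0) ∂(ν.prod ν) = 0 := by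
      rw [lintegral_prod _ (by fun_prop), ← lintegral_zero (μ := ν)]
      refine lintegral_congr_ae ?_
      filter_upwards [hν.nonneg] with s hs
      rw [max_eq_right (by linarith)]
      simp
    rw [h0, mul_zero, zero_add]
    have h1 : ∫⁻ x, ∫⁻ q : ℝ × ℝ, ENNReal.ofReal (max (x - q.1) 0) ∂(ν.prod ν) ∂V
        ≤ ∫⁻ x, ENNReal.ofReal (K + 1) ∂V := by
      refine lintegral_mono_ae ?_
      filter_upwards [ae_restrict_mem measurableSet_Icc] with x hx
      calc _ ≤ ∫⁻ s, ENNReal.ofReal (K + 1) ∂ν := by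
            rw [lintegral_prod _ (by fun_prop)]
            refine lintegral_mono_ae ?_
            filter_upwards [hν.nonneg] with s hs
            rw [lintegral_const, measure_univ, mul_one]
            exact ENNReal.ofReal_le_ofReal (max_le (by linarith [hx.2]) (by linarith))
        _ = _ := by simp
    calc _ ≤ ENNReal.ofReal δ * ENNReal.ofReal (K + 1) := by
          refine mul_le_mul' le_rfl (h1.trans_eq ?_)
          simp [hV]
      _ ≤ _ := by
          rw [← ENNReal.ofReal_mul hδ0.le]
          exact ENNReal.ofReal_le_ofReal hδa
  · exact Measure.le_iff.2 fun A _ => by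
      rw [Measure.smul_apply, Measure.smul_apply]
      exact mul_le_mul' le_rfl (Measure.restrict_apply_le _ _)
  · exact Measure.le_iff.2 fun A _ => by
      rw [Measure.smul_apply, Measure.smul_apply]
      exact mul_le_mul' le_rfl (hη₀vol A)
  · exact Measure.ae_smul_measure hη₀B _

theorem mutualInfo_le_infoSup (𝕋 : TimeModel) (ν : Measure ℝ) (a : ℝ) (ρ : Measure ℝ)
    (hρ : IsProbabilityMeasure ρ) (hmem : ∀ᵐ x ∂ρ, x ∈ 𝕋.instants)
    (hmean : ∫⁻ ω, ENNReal.ofReal (max (ω.1 - ω.2.1) 0) ∂(ρ.prod (ν.prod ν))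
      ≤ ENNReal.ofReal a) :
    mutualInfo (ρ.prod (ν.prod ν)) (fun ω => max (ω.1 - ω.2.1) 0)
      (fun ω => max (ω.1 - ω.2.1) 0 + ω.2.2) ≤ infoSup 𝕋 ν a := by
  unfold infoSup
  exact le_iSup_of_le ρ (le_iSup_of_le hρ (le_iSup_of_le hmem (le_iSup_of_le hmean le_rfl)))

/-- Jensen's inequality for the exponential function, with values in `ℝ≥0∞`. -/
theorem ofReal_exp_neg_integral_le {η : Measure ℝ} [IsProbabilityMeasure η] {φ : ℝ → ℝ}
    (hφ : Integrable φ η) :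
    ENNReal.ofReal (Real.exp (-∫ r, φ r ∂η)) ≤ ∫⁻ r, ENNReal.ofReal (Real.exp (-φ r)) ∂η := by
  have hm : AEStronglyMeasurable (fun r => Real.exp (-φ r)) η :=
    Real.continuous_exp.comp_aestronglyMeasurable hφ.neg.aestronglyMeasurable
  by_cases hint : Integrable (fun r => Real.exp (-φ r)) η
  · rw [← ofReal_integral_eq_lintegral_ofReal hint (ae_of_all _ fun r => (Real.exp_pos _).le)]
    refine ENNReal.ofReal_le_ofReal ?_
    rw [← integral_neg]
    exact convexOn_exp.map_integral_le Real.continuous_exp.continuousOn isClosed_univ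
      (by simp) hφ.neg hint
  · have : ∫⁻ r, ENNReal.ofReal (Real.exp (-φ r)) ∂η = ⊤ := by
      by_contra hne
      exact hint ((lintegral_ofReal_ne_top_iff_integrable hm
        (ae_of_all _ fun r => (Real.exp_pos _).le)).1 hne)
    rw [this]
    exact le_top

theorem inv_one_add_sq_le {w r B : ℝ} (hr : 0 ≤ r) (hrB : r ≤ B) :
    (1 + w ^ 2)⁻¹ ≤ (2 + 2 * B ^ 2) * (1 + (w - r) ^ 2)⁻¹ := by
  have hB : r ^ 2 ≤ B ^ 2 := pow_le_pow_left₀ hr hrB 2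
  rw [inv_eq_one_div, ← div_eq_mul_inv, div_le_div_iff₀ (by positivity) (by positivity)]
  nlinarith [sq_nonneg (w + r), mul_nonneg (sq_nonneg w) (sq_nonneg B), sq_nonneg B, sq_nonneg w]

/-- In continuous time, suppose the information supremum is finite. Then one finite measure `Q₁`
serves as reference output law for all constant inputs `w`, up to a factor that depends on `w` only
polynomially. Write the input as `w = (w - r) + r`, where `r` is random with a law for which the
channel from `r` to `r + S` has a finite mean log-likelihood ratio; as `r` has a bounded density
with bounded support, the law of `w - r` is dominated by a multiple of the Cauchy law. -/
theorem exists_firstDepartureLaw_continuous {μ : ℝ} (ν : Measure ℝ) [IsProbabilityMeasure ν]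
    (hν : IsServiceLaw .continuous μ ν) {a : ℝ} (ha : 0 < a)
    (hfin : infoSup .continuous ν a ≠ ⊤) :
    ∃ (Q₁ : Measure ℝ) (ℓ : ℝ → ℝ), IsFiniteMeasure Q₁ ∧ Measurable ℓ ∧ Integrable ℓ ν ∧
      ∀ (w : ℝ) (h : ℝ → ℝ≥0∞), Measurable h →
        ∫⁻ s, h (w + s) * ENNReal.ofReal ((1 + w ^ 2)⁻¹ * Real.exp (-ℓ s)) ∂ν
          ≤ ∫⁻ y, h y ∂Q₁ := by
  obtain ⟨ρ, η, B, C, hρ, hη, hmean, hC, hηW, hηvol, hηB⟩ := exists_law_with_density ν hν ha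
  have hmi := ne_top_of_le_ne_top hfin (mutualInfo_le_infoSup .continuous ν a ρ hρ
    (ae_of_all _ fun x => Set.mem_univ x) hmean)
  obtain ⟨Q, g, hQ, hgm, hgint, -, hgood⟩ := exists_logLikelihood ρ ν hmi
  have hgoodη := ae_mono hηW (Measure.ae_smul_measure hgood C)
  have hgη : Integrable (fun p : ℝ × ℝ => g (p.1, p.1 + p.2)) (η.prod ν) := by
    rw [jointLaw_eq_map] at hgint
    have h1 := (integrable_map_measure hgm.aestronglyMeasurable (by fun_prop)).1 hgint
    have h2 : (C • idleLaw ρ ν).prod ν = C • (idleLaw ρ ν).prod ν := Measure.prod_smul_left C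
    refine (h1.smul_measure hC).mono_measure ?_
    rw [← h2]
    exact Measure.prod_mono hηW le_rfl
  -- Averaging `g` over `r` instead of `exp (-g)` costs Jensen's inequality but keeps the mean.
  set ℓ : ℝ → ℝ := fun s => ∫ r, g (r, r + s) ∂η with hℓ
  have hℓm : Measurable ℓ := by
    have : StronglyMeasurable fun p : ℝ × ℝ => g (p.1, p.1 + p.2) :=
      (by fun_prop : Measurable fun p : ℝ × ℝ => g (p.1, p.1 + p.2)).stronglyMeasurable
    exact this.integral_prod_left'.measurable
  have hℓint : Integrable ℓ ν := hgη.integral_prod_right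
  have hsec : ∀ᵐ s ∂ν, Integrable (fun r => g (r, r + s)) η := hgη.prod_left_ae
  set b : ℝ := 2 + 2 * B ^ 2 with hb
  have hb0 : 0 ≤ b := by positivity
  set τ : Measure ℝ := volume.withDensity fun t => ENNReal.ofReal ((1 + t ^ 2)⁻¹) with hτ
  have hτfin : IsFiniteMeasure τ := isFiniteMeasure_withDensity_ofReal
    integrable_inv_one_add_sq.2
  refine ⟨(C * ENNReal.ofReal b) • (τ.prod Q).map (fun p => p.1 + p.2), ℓ, ?_, hℓm, hℓint, ?_⟩
  · exact Measure.smul_finite _ (ENNReal.mul_ne_top hC ENNReal.ofReal_ne_top)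
  intro w h hh
  set H : ℝ → ℝ≥0∞ := fun t => ∫⁻ y, h (t + y) ∂Q with hH
  have hHm : Measurable H := by
    exact Measurable.lintegral_prod_right' (f := fun p : ℝ × ℝ => h (p.1 + p.2)) (by fun_prop)
  set q : ℝ → ℝ≥0∞ := fun t => ENNReal.ofReal ((1 + t ^ 2)⁻¹) with hq
  have hqm : Measurable q := by fun_prop
  calc ∫⁻ s, h (w + s) * ENNReal.ofReal ((1 + w ^ 2)⁻¹ * Real.exp (-ℓ s)) ∂ν
      ≤ ∫⁻ s, ∫⁻ r, q w * (h (w + s) * ENNReal.ofReal (Real.exp (-g (r, r + s)))) ∂η ∂ν := by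
        refine lintegral_mono_ae ?_
        filter_upwards [hsec] with s hs
        rw [lintegral_const_mul _ (by fun_prop), lintegral_const_mul _ (by fun_prop),
          ENNReal.ofReal_mul (by positivity), mul_left_comm]
        gcongr
        exact ofReal_exp_neg_integral_le hs
    _ = ∫⁻ r, q w * ∫⁻ s, h ((w - r) + (r + s)) *
          ENNReal.ofReal (Real.exp (-g (r, r + s))) ∂ν ∂η := by
        rw [lintegral_lintegral_swap (by fun_prop)]
        refine lintegral_congr fun r => ?_
        rw [lintegral_const_mul _ (by fun_prop)]
        simp_rw [show ∀ s, w - r + (r + s) = w + s from fun s => by ring]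
    _ ≤ ∫⁻ r, ENNReal.ofReal b * (q (w - r) * H (w - r)) ∂η := by
        refine lintegral_mono_ae ?_
        filter_upwards [hgoodη, hηB] with r hr hrB
        rw [← mul_assoc, hq, ← ENNReal.ofReal_mul hb0]
        refine mul_le_mul' (ENNReal.ofReal_le_ofReal (inv_one_add_sq_le hrB.1 hrB.2)) ?_
        exact hr (fun y => h (w - r + y)) (by fun_prop)
    _ ≤ ∫⁻ r, ENNReal.ofReal b * (q (w - r) * H (w - r)) ∂(C • volume) :=
        lintegral_mono' hηvol le_rfl
    _ = C * ENNReal.ofReal b * ∫⁻ t, q t * H t ∂volume := by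
        rw [lintegral_smul_measure, smul_eq_mul, lintegral_const_mul _ (by fun_prop), mul_assoc,
          lintegral_sub_left_eq_self (μ := volume) (fun t => q t * H t) w]
    _ = _ := by
        rw [lintegral_smul_measure, smul_eq_mul, lintegral_map hh (by fun_prop),
          lintegral_prod _ (by fun_prop), hτ,
          lintegral_withDensity_eq_lintegral_mul _ hqm hHm]
        rfl

/-- A reference law for the first departure, in both time models. -/
theorem exists_firstDepartureLaw {𝕋 : TimeModel} {μ : ℝ} (ν : Measure ℝ) [IsProbabilityMeasure ν]
    (hν : IsServiceLaw 𝕋 μ ν) {a : ℝ} (ha : 0 < a) (hfin : infoSup 𝕋 ν a ≠ ⊤) :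
    ∃ (Q₁ : Measure ℝ) (ℓ : ℝ → ℝ), IsFiniteMeasure Q₁ ∧ Measurable ℓ ∧ Integrable ℓ ν ∧
      ∀ w ∈ 𝕋.instants, ∀ h : ℝ → ℝ≥0∞, Measurable h →
        ∫⁻ s, h (w + s) * ENNReal.ofReal ((1 + w ^ 2)⁻¹ * Real.exp (-ℓ s)) ∂ν
          ≤ ∫⁻ y, h y ∂Q₁ := by
  cases 𝕋 with
  | continuous =>
    obtain ⟨Q₁, ℓ, h1, h2, h3, h4⟩ := exists_firstDepartureLaw_continuous ν hν ha hfin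
    exact ⟨Q₁, ℓ, h1, h2, h3, fun w _ => h4 w⟩
  | discrete =>
    obtain ⟨Q₁, h1, h2⟩ := exists_firstDepartureLaw_discrete ν
    exact ⟨Q₁, fun _ => 0, h1, measurable_const, integrable_zero _ _ _, by simpa using h2⟩

/-! ### Comparison of the departure process with a reference law -/

/-- A reference law for the departures `0, …, k`, extended by zero: the first one follows `Q₁`, and
the later interdeparture times are i.i.d. of law `Q`. -/
def referenceLaw (Q₁ Q : Measure ℝ) : ℕ → Measure (ℕ → ℝ)
  | 0 => Q₁.map (Function.update (fun _ => 0) 0)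
  | k + 1 => ((referenceLaw Q₁ Q k).prod Q).map
      (fun p => Function.update p.1 (k + 1) (p.1 k + p.2))

/-- The departure times of packets `0, …, k`, extended by zero. -/
def departuresUpTo (f : (i : ℕ) → (Fin i → ℝ) → ℝ) (s : ℕ → ℝ) (k : ℕ) : ℕ → ℝ :=
  fun j => if j ≤ k then departure f s j else 0

/-- The log-likelihood ratio (up to an inequality) of the departures `0, …, k` against
`referenceLaw`. -/
def logRatio (ℓ : ℝ → ℝ) (g : ℝ × ℝ → ℝ) (f : (i : ℕ) → (Fin i → ℝ) → ℝ) (s : ℕ → ℝ) (k : ℕ) : ℝ :=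
  Real.log (1 + arrival f s 0 ^ 2) + ℓ (s 0)
    + ∑ i ∈ Finset.range k, g (idle f s (i + 1), idle f s (i + 1) + s (i + 1))

theorem measurable_update_add (k : ℕ) :
    Measurable (fun p : (ℕ → ℝ) × ℝ => Function.update p.1 (k + 1) (p.1 k + p.2)) :=
  (measurable_update_prod (k + 1)).comp
    (measurable_fst.prodMk (((measurable_pi_apply k).comp measurable_fst).add measurable_snd))

theorem referenceLaw_univ (Q₁ Q : Measure ℝ) [IsFiniteMeasure Q₁] [IsProbabilityMeasure Q] (k : ℕ) :
    referenceLaw Q₁ Q k Set.univ = Q₁ Set.univ := by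
  induction k with
  | zero => rw [referenceLaw, Measure.map_apply (measurable_update _) MeasurableSet.univ]; simp
  | succ k ih =>
    have : IsFiniteMeasure (referenceLaw Q₁ Q k) := ⟨by rw [ih]; exact measure_lt_top _ _⟩
    rw [referenceLaw, Measure.map_apply (measurable_update_add k) MeasurableSet.univ,
      Set.preimage_univ, ← Set.univ_prod_univ, Measure.prod_prod, measure_univ (μ := Q), mul_one, ih]

instance (Q₁ Q : Measure ℝ) [IsFiniteMeasure Q₁] [IsProbabilityMeasure Q] (k : ℕ) :
    IsFiniteMeasure (referenceLaw Q₁ Q k) :=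
  ⟨by rw [referenceLaw_univ]; exact measure_lt_top _ _⟩

theorem departuresUpTo_zero (f : (i : ℕ) → (Fin i → ℝ) → ℝ) (s : ℕ → ℝ) :
    departuresUpTo f s 0 = Function.update (fun _ => 0) 0 (arrival f s 0 + s 0) := by
  ext j
  rcases eq_or_ne j 0 with rfl | hj
  · simp [departuresUpTo, departure_zero]
  · simp [departuresUpTo, hj]

theorem departuresUpTo_succ (f : (i : ℕ) → (Fin i → ℝ) → ℝ) (s : ℕ → ℝ) (k : ℕ) :
    departuresUpTo f s (k + 1) = Function.update (departuresUpTo f s k) (k + 1)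
      (departuresUpTo f s k k + (idle f s (k + 1) + s (k + 1))) := by
  ext j
  rcases eq_or_ne j (k + 1) with rfl | hj
  · simp [departuresUpTo, departure_succ]
  · have : j ≤ k + 1 ↔ j ≤ k := by omega
    simp [departuresUpTo, hj, this]

theorem departuresUpTo_update (f : (i : ℕ) → (Fin i → ℝ) → ℝ) (s : ℕ → ℝ) (k : ℕ) (t : ℝ) :
    departuresUpTo f (Function.update s (k + 1) t) k = departuresUpTo f s k := by
  ext j
  by_cases hj : j ≤ k
  · simp [departuresUpTo, hj, departure_update f s (k + 1) t j (by omega)]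
  · simp [departuresUpTo, hj]

theorem logRatio_update (ℓ : ℝ → ℝ) (g : ℝ × ℝ → ℝ) (f : (i : ℕ) → (Fin i → ℝ) → ℝ) (s : ℕ → ℝ)
    (k : ℕ) (t : ℝ) :
    logRatio ℓ g f (Function.update s (k + 1) t) k = logRatio ℓ g f s k := by
  rw [logRatio, logRatio, arrival_zero f _ s, Function.update_of_ne (by omega)]
  congr 1
  refine Finset.sum_congr rfl fun i hi => ?_
  rw [Finset.mem_range] at hi
  rw [idle_update f s _ t _ (by omega), Function.update_of_ne (by omega)]

theorem logRatio_succ (ℓ : ℝ → ℝ) (g : ℝ × ℝ → ℝ) (f : (i : ℕ) → (Fin i → ℝ) → ℝ) (s : ℕ → ℝ)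
    (k : ℕ) : logRatio ℓ g f s (k + 1) = logRatio ℓ g f s k
      + g (idle f s (k + 1), idle f s (k + 1) + s (k + 1)) := by
  rw [logRatio, logRatio, Finset.sum_range_succ, ← add_assoc]

theorem measurable_departuresUpTo {f : (i : ℕ) → (Fin i → ℝ) → ℝ} {n : ℕ}
    (hf : ∀ i < n, Measurable (f i)) (k : ℕ) (hk : k < n) :
    Measurable fun s => departuresUpTo f s k := by
  refine measurable_pi_lambda _ fun j => ?_
  by_cases hj : j ≤ k
  · simpa [departuresUpTo, hj] using measurable_departure hf j (by omega)
  · simp [departuresUpTo, hj]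

theorem measurable_logRatio {f : (i : ℕ) → (Fin i → ℝ) → ℝ} {n : ℕ}
    (hf : ∀ i < n, Measurable (f i)) {ℓ : ℝ → ℝ} (hℓ : Measurable ℓ) {g : ℝ × ℝ → ℝ}
    (hg : Measurable g) (k : ℕ) (hk : k < n) :
    Measurable fun s => logRatio ℓ g f s k := by
  have h0 := measurable_arrival hf 0 (by omega)
  refine Measurable.add (by fun_prop) (Finset.measurable_fun_sum _ fun i hi => ?_)
  rw [Finset.mem_range] at hi
  have := measurable_idle hf (i + 1) (by omega)
  fun_prop

/-- The factor `exp (-logRatio)` turns the law of the departures into a measure dominated by the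
reference law. Each step integrates out the last service time, of which the earlier departures and
the last idle time are independent. -/
theorem lintegral_mul_exp_neg_logRatio_le {ν : Measure ℝ} [IsProbabilityMeasure ν]
    {f : (i : ℕ) → (Fin i → ℝ) → ℝ} {n : ℕ}
    (hf : ∀ i < n, Measurable (f i)) {ℓ : ℝ → ℝ} (hℓ : Measurable ℓ) {g : ℝ × ℝ → ℝ}
    (hg : Measurable g) {Q₁ Q : Measure ℝ} [IsFiniteMeasure Q₁] [IsProbabilityMeasure Q]
    (hfirst : ∀ (s : ℕ → ℝ) (h : ℝ → ℝ≥0∞), Measurable h →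
      ∫⁻ t, h (arrival f s 0 + t) *
        ENNReal.ofReal ((1 + arrival f s 0 ^ 2)⁻¹ * Real.exp (-ℓ t)) ∂ν ≤ ∫⁻ y, h y ∂Q₁)
    (hnext : ∀ i < n, ∀ᵐ s ∂(serviceProcess ν), ∀ h : ℝ → ℝ≥0∞, Measurable h →
      ∫⁻ t, h (idle f s i + t) * ENNReal.ofReal (Real.exp (-g (idle f s i, idle f s i + t))) ∂ν
        ≤ ∫⁻ y, h y ∂Q)
    (k : ℕ) (hk : k < n) (φ : (ℕ → ℝ) → ℝ≥0∞) (hφ : Measurable φ) :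
    ∫⁻ s, φ (departuresUpTo f s k) * ENNReal.ofReal (Real.exp (-logRatio ℓ g f s k))
      ∂(serviceProcess ν) ≤ ∫⁻ x, φ x ∂(referenceLaw Q₁ Q k) := by
  induction k generalizing φ with
  | zero =>
    have h1 : ∀ s, φ (departuresUpTo f s 0) * ENNReal.ofReal (Real.exp (-logRatio ℓ g f s 0))
        = φ (Function.update (fun _ => 0) 0 (arrival f s 0 + s 0)) *
          ENNReal.ofReal ((1 + arrival f s 0 ^ 2)⁻¹ * Real.exp (-ℓ (s 0))) := fun s => by
      rw [departuresUpTo_zero, logRatio, Finset.range_zero, Finset.sum_empty, add_zero, neg_add,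
        Real.exp_add, Real.exp_neg (Real.log _), Real.exp_log (by positivity)]
    have hm : Measurable fun s => φ (departuresUpTo f s 0) *
        ENNReal.ofReal (Real.exp (-logRatio ℓ g f s 0)) :=
      (hφ.comp (measurable_departuresUpTo hf 0 hk)).mul (ENNReal.measurable_ofReal.comp
        (Real.measurable_exp.comp (measurable_logRatio hf hℓ hg 0 hk).neg))
    rw [lintegral_serviceProcess_update ν 0 hm, referenceLaw,
      lintegral_map hφ (measurable_update _)]
    calc _ ≤ ∫⁻ _ : ℕ → ℝ, ∫⁻ x, φ (Function.update (fun _ => 0) 0 x) ∂Q₁ ∂(serviceProcess ν) := by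
          refine lintegral_mono fun s => ?_
          refine le_trans (le_of_eq ?_) (hfirst s (fun x => φ (Function.update (fun _ => 0) 0 x))
            (hφ.comp (measurable_update _)))
          refine lintegral_congr fun t => ?_
          have := h1 (Function.update s 0 t)
          rw [arrival_zero f _ s, Function.update_self] at this
          exact this
      _ = _ := by simp
  | succ k ih =>
    have hm : Measurable fun s => φ (departuresUpTo f s (k + 1)) *
        ENNReal.ofReal (Real.exp (-logRatio ℓ g f s (k + 1))) :=
      (hφ.comp (measurable_departuresUpTo hf (k + 1) hk)).mul (ENNReal.measurable_ofReal.comp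
        (Real.measurable_exp.comp (measurable_logRatio hf hℓ hg (k + 1) hk).neg))
    have hψ : Measurable fun x : ℕ → ℝ => ∫⁻ y, φ (Function.update x (k + 1) (x k + y)) ∂Q :=
      Measurable.lintegral_prod_right' (f := fun p : (ℕ → ℝ) × ℝ =>
        φ (Function.update p.1 (k + 1) (p.1 k + p.2))) (hφ.comp (measurable_update_add k))
    rw [lintegral_serviceProcess_update ν (k + 1) hm, referenceLaw,
      lintegral_map hφ (measurable_update_add k),
      lintegral_prod (fun p : (ℕ → ℝ) × ℝ => φ (Function.update p.1 (k + 1) (p.1 k + p.2)))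
        (hφ.comp (measurable_update_add k)).aemeasurable]
    refine le_trans (lintegral_mono_ae ?_) (ih (by omega) _ hψ)
    filter_upwards [hnext (k + 1) hk] with s hs
    set x := departuresUpTo f s k
    have hφx : Measurable fun y => φ (Function.update x (k + 1) (x k + y)) :=
      hφ.comp ((measurable_update _).comp (measurable_const.add measurable_id))
    refine le_trans (le_of_eq ?_) (mul_le_mul' (hs _ hφx)
      (le_refl (ENNReal.ofReal (Real.exp (-logRatio ℓ g f s k)))))
    rw [← lintegral_mul_const _ (by fun_prop)]
    refine lintegral_congr fun t => ?_
    rw [departuresUpTo_succ, departuresUpTo_update, logRatio_succ, logRatio_update,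
      idle_update f s _ t _ le_rfl, Function.update_self, neg_add, Real.exp_add,
      ENNReal.ofReal_mul (Real.exp_pos _).le, mul_assoc,
      mul_comm (ENNReal.ofReal (Real.exp (-logRatio ℓ g f s k)))]

theorem ofReal_integral_le_lintegral {α : Type*} [MeasurableSpace α] {m : Measure α} {Z : α → ℝ}
    (hZ : Integrable Z m) :
    ENNReal.ofReal (∫ x, Z x ∂m) ≤ ∫⁻ x, ENNReal.ofReal (Z x) ∂m := by
  calc ENNReal.ofReal (∫ x, Z x ∂m) ≤ ENNReal.ofReal (∫ x, max (Z x) 0 ∂m) :=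
        ENNReal.ofReal_le_ofReal (integral_mono hZ hZ.pos_part fun x => le_max_left _ _)
    _ = ∫⁻ x, ENNReal.ofReal (max (Z x) 0) ∂m :=
        ofReal_integral_eq_lintegral_ofReal hZ.pos_part (ae_of_all _ fun x => le_max_right _ _)
    _ = _ := by simp

/-- The weak converse in one-shot form. If `G u` is the event that message `u` is decoded, the
bound follows from `z ≤ exp z` for `z = 1_{G u} log M - logRatio`: by the comparison with the
reference law, which does not depend on `u`, the means of `exp z` add up to at most
`2 * M * Q₁ univ`, since the decoding regions are disjoint. -/
theorem log_mul_sum_correct_le {𝕋 : TimeModel} {ν : Measure ℝ} [IsProbabilityMeasure ν] {n M : ℕ}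
    (c : WeakFeedbackCode 𝕋 n M) {ℓ : ℝ → ℝ} (hℓ : Measurable ℓ) {g : ℝ × ℝ → ℝ}
    (hg : Measurable g) {Q₁ Q : Measure ℝ} [IsFiniteMeasure Q₁] [IsProbabilityMeasure Q]
    (hfirst : ∀ u, ∀ (s : ℕ → ℝ) (h : ℝ → ℝ≥0∞), Measurable h →
      ∫⁻ t, h (arrival (c.enc u) s 0 + t) *
        ENNReal.ofReal ((1 + arrival (c.enc u) s 0 ^ 2)⁻¹ * Real.exp (-ℓ t)) ∂ν ≤ ∫⁻ y, h y ∂Q₁)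
    (hnext : ∀ u, ∀ i < n, ∀ᵐ s ∂(serviceProcess ν), ∀ h : ℝ → ℝ≥0∞, Measurable h →
      ∫⁻ t, h (idle (c.enc u) s i + t) *
        ENNReal.ofReal (Real.exp (-g (idle (c.enc u) s i, idle (c.enc u) s i + t))) ∂ν
        ≤ ∫⁻ y, h y ∂Q)
    (hint : ∀ u, Integrable (fun s => logRatio ℓ g (c.enc u) s (n - 1)) (serviceProcess ν)) :
    Real.log M * ∑ u : Fin M, (serviceProcess ν).real
        {s | c.dec (fun i : Fin n => departure (c.enc u) s i) = u}
      ≤ ∑ u : Fin M, ∫ s, logRatio ℓ g (c.enc u) s (n - 1) ∂(serviceProcess ν)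
        + 2 * Q₁.real Set.univ * M := by
  have hn := c.n_pos
  have hM : 0 < M := (c.dec 0).pos
  have hM1 : (1 : ℝ) ≤ M := by exact_mod_cast hM
  set P := serviceProcess ν
  set D : Fin M → Set (ℕ → ℝ) := fun u => {x | c.dec (fun i : Fin n => x i) = u} with hD
  have hDm : ∀ u, MeasurableSet (D u) := fun u =>
    (c.measurable_dec.comp (measurable_pi_lambda _ fun i => measurable_pi_apply _))
      (measurableSet_singleton u)
  set G : Fin M → Set (ℕ → ℝ) := fun u =>
    {s | c.dec (fun i : Fin n => departure (c.enc u) s i) = u} with hG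
  have hGD : ∀ u s, s ∈ G u ↔ departuresUpTo (c.enc u) s (n - 1) ∈ D u := fun u s => by
    have : (fun i : Fin n => departuresUpTo (c.enc u) s (n - 1) i)
        = fun i : Fin n => departure (c.enc u) s i := by
      ext i
      have : (i : ℕ) ≤ n - 1 := by omega
      simp [departuresUpTo, this]
    simp only [hG, hD, Set.mem_ofPred_eq, this]
  have hGm : ∀ u, MeasurableSet (G u) := fun u => by
    have : G u = (fun s => departuresUpTo (c.enc u) s (n - 1)) ⁻¹' D u := by
      ext s; exact hGD u s
    rw [this]
    exact measurable_departuresUpTo (c.measurable_enc u) (n - 1) (by omega) (hDm u)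
  set Z : Fin M → (ℕ → ℝ) → ℝ := fun u s =>
    (G u).indicator (fun _ => Real.log M) s - logRatio ℓ g (c.enc u) s (n - 1) with hZ
  have hindint : ∀ u, Integrable ((G u).indicator (fun _ => Real.log M)) P := fun u =>
    (integrable_const _).indicator (hGm u)
  have hZint : ∀ u, Integrable (Z u) P := fun u => (hindint u).sub (hint u)
  set ψ : Fin M → (ℕ → ℝ) → ℝ≥0∞ := fun u x => 1 + (D u).indicator (fun _ => (M : ℝ≥0∞)) x with hψ
  have hψm : ∀ u, Measurable (ψ u) := fun u =>
    (measurable_const.indicator (hDm u)).const_add 1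
  have hstep : ∀ u, ENNReal.ofReal (∫ s, Z u s ∂P) ≤ ∫⁻ x, ψ u x ∂(referenceLaw Q₁ Q (n - 1)) := by
    intro u
    refine (ofReal_integral_le_lintegral (hZint u)).trans (le_trans (lintegral_mono fun s => ?_)
      (lintegral_mul_exp_neg_logRatio_le (c.measurable_enc u) hℓ hg (hfirst u) (hnext u)
        (n - 1) (by omega) (ψ u) (hψm u)))
    have hle : Z u s ≤ Real.exp (Z u s) := by linarith [Real.add_one_le_exp (Z u s)]
    refine (ENNReal.ofReal_le_ofReal hle).trans ?_
    by_cases hs : s ∈ G u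
    · have hs' := (hGD u s).1 hs
      simp only [hZ, hψ, Set.indicator_of_mem hs, Set.indicator_of_mem hs']
      rw [sub_eq_add_neg, Real.exp_add, Real.exp_log (by positivity),
        ENNReal.ofReal_mul (by positivity), ENNReal.ofReal_natCast]
      gcongr
      exact le_add_self
    · have hs' := fun h => hs ((hGD u s).2 h)
      simp only [hZ, hψ, Set.indicator_of_notMem hs, Set.indicator_of_notMem hs']
      simp
  have hsum : ∑ u, ∫⁻ x, ψ u x ∂(referenceLaw Q₁ Q (n - 1)) = 2 * M * Q₁ Set.univ := by
    rw [← lintegral_finsetSum _ fun u _ => hψm u]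
    have : ∀ x, ∑ u, ψ u x = 2 * M := fun x => by
      have h1 : ∀ u, (D u).indicator (fun _ => (M : ℝ≥0∞)) x
          = if c.dec (fun i : Fin n => x i) = u then (M : ℝ≥0∞) else 0 := fun u => by
        simp [Set.indicator_apply, hD]
      simp only [hψ, Finset.sum_add_distrib, h1]
      simp [two_mul]
    simp_rw [this]
    rw [lintegral_const, referenceLaw_univ]
  have hfin : ∀ u, ∫⁻ x, ψ u x ∂(referenceLaw Q₁ Q (n - 1)) ≠ ⊤ := fun u => by
    refine ne_top_of_le_ne_top ?_ ((Finset.single_le_sum (f := fun u =>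
      ∫⁻ x, ψ u x ∂(referenceLaw Q₁ Q (n - 1))) (fun _ _ => zero_le) (Finset.mem_univ u)).trans_eq
        hsum)
    exact ENNReal.mul_ne_top (ENNReal.mul_ne_top (by simp) (by simp)) (measure_ne_top _ _)
  have hreal : ∑ u, ∫ s, Z u s ∂P ≤ 2 * M * Q₁.real Set.univ := by
    calc ∑ u, ∫ s, Z u s ∂P
        ≤ ∑ u, (∫⁻ x, ψ u x ∂(referenceLaw Q₁ Q (n - 1))).toReal :=
          Finset.sum_le_sum fun u _ => (ENNReal.ofReal_le_iff_le_toReal (hfin u)).1 (hstep u)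
      _ = _ := by
          rw [← ENNReal.toReal_sum fun u _ => hfin u, hsum]
          simp [Measure.real]
  have hZeq : ∀ u, ∫ s, Z u s ∂P
      = Real.log M * P.real (G u) - ∫ s, logRatio ℓ g (c.enc u) s (n - 1) ∂P := fun u => by
    rw [integral_sub (hindint u) (hint u), integral_indicator_const _ (hGm u), smul_eq_mul,
      mul_comm]
  simp_rw [hZeq, Finset.sum_sub_distrib, ← Finset.mul_sum] at hreal
  linarith

/-! ### The average input law of a code -/

theorem measurableSet_instants (𝕋 : TimeModel) : MeasurableSet 𝕋.instants := by
  cases 𝕋 with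
  | continuous => exact MeasurableSet.univ
  | discrete => exact (Set.countable_range _).measurableSet

theorem zero_mem_instants (𝕋 : TimeModel) : (0 : ℝ) ∈ 𝕋.instants := by
  cases 𝕋 with
  | continuous => exact Set.mem_univ _
  | discrete => exact ⟨0, by simp⟩

theorem add_mem_instants {𝕋 : TimeModel} {x y : ℝ} (hx : x ∈ 𝕋.instants) (hy : y ∈ 𝕋.instants) :
    x + y ∈ 𝕋.instants := by
  cases 𝕋 with
  | continuous => exact Set.mem_univ _
  | discrete =>
    obtain ⟨a, rfl⟩ := hx
    obtain ⟨b, rfl⟩ := hy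
    exact ⟨a + b, by simp⟩

theorem sub_mem_instants {𝕋 : TimeModel} {x y : ℝ} (hx : x ∈ 𝕋.instants) (hy : y ∈ 𝕋.instants) :
    x - y ∈ 𝕋.instants := by
  cases 𝕋 with
  | continuous => exact Set.mem_univ _
  | discrete =>
    obtain ⟨a, rfl⟩ := hx
    obtain ⟨b, rfl⟩ := hy
    exact ⟨a - b, by simp⟩

theorem start_mem_instants {𝕋 : TimeModel} {n M : ℕ} (c : WeakFeedbackCode 𝕋 n M) (u : Fin M)
    {s : ℕ → ℝ} (hs : IsServiceSeq 𝕋 s) (i : ℕ) (hi : i < n) :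
    start (c.enc u) s i ∈ 𝕋.instants := by
  induction i with
  | zero => rw [start_zero]; exact c.arrival_mem u s hs 0 hi
  | succ i ih =>
    have h1 := add_mem_instants (ih (by omega)) (hs i).2
    have h2 := c.arrival_mem u s hs (i + 1) hi
    rw [arrival] at h2
    rw [start]
    rcases max_choice (start (c.enc u) s i + s i)
      (c.enc u (i + 1) (fun k : Fin (i + 1) => start (c.enc u) s k)) with h | h
    · rw [h]; exact h1
    · rw [h]; exact h2

theorem lead_mem_instants {𝕋 : TimeModel} {n M : ℕ} (c : WeakFeedbackCode 𝕋 n M) (u : Fin M)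
    {s : ℕ → ℝ} (hs : IsServiceSeq 𝕋 s) (i : ℕ) (hi : i < n) :
    lead (c.enc u) s i ∈ 𝕋.instants := by
  cases i with
  | zero => exact zero_mem_instants 𝕋
  | succ i =>
    exact sub_mem_instants (c.arrival_mem u s hs _ hi) (start_mem_instants c u hs i (by omega))

theorem isServiceSeq_zero (𝕋 : TimeModel) : IsServiceSeq 𝕋 (fun _ => 0) :=
  fun _ => ⟨le_rfl, zero_mem_instants 𝕋⟩

theorem departure_eq_sum (f : (i : ℕ) → (Fin i → ℝ) → ℝ) (s : ℕ → ℝ) (k : ℕ) :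
    departure f s k = arrival f s 0 + ∑ i ∈ Finset.range (k + 1), (idle f s i + s i) := by
  induction k with
  | zero => simp [departure_zero, idle]
  | succ k ih => rw [departure_succ, ih, Finset.sum_range_succ _ (k + 1), add_assoc]

/-- The server is busy during `n / μ` units of time on average, so the rest of the time until the
last departure bounds the idle periods, including the one before the first arrival. -/
theorem sum_lintegral_idle_le {𝕋 : TimeModel} {μ lam : ℝ} (hlam : 0 < lam) (hlt : lam < μ)
    {ν : Measure ℝ} [IsProbabilityMeasure ν] (hν : IsServiceLaw 𝕋 μ ν) {n M : ℕ}
    (c : WeakFeedbackCode 𝕋 n M)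
    (hc : c.meanLastDeparture ν ≤ ENNReal.ofReal (n / lam)) :
    ∑ u : Fin M, (ENNReal.ofReal (arrival (c.enc u) (fun _ => 0) 0) +
        ∑ i : Fin n, ∫⁻ s, ENNReal.ofReal (idle (c.enc u) s i) ∂(serviceProcess ν))
      ≤ M * (n * ENNReal.ofReal (1 / lam - 1 / μ)) := by
  have hn := c.n_pos
  have hM : 0 < M := (c.dec 0).pos
  have hμ : 0 < μ := hlam.trans hlt
  have ha : 0 ≤ 1 / lam - 1 / μ := sub_nonneg.2 (one_div_le_one_div_of_le hlam hlt.le)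
  set A : Fin M → ℝ≥0∞ := fun u => ENNReal.ofReal (arrival (c.enc u) (fun _ => 0) 0) +
        ∑ i : Fin n, ∫⁻ s, ENNReal.ofReal (idle (c.enc u) s i) ∂(serviceProcess ν) with hA
  have hdep : ∀ u, ∫⁻ s, ENNReal.ofReal (departure (c.enc u) s (n - 1)) ∂(serviceProcess ν)
      = A u + n * ENNReal.ofReal (1 / μ) := by
    intro u
    have hidle : ∀ i : Fin n, Measurable fun s => idle (c.enc u) s i :=
      fun i => measurable_idle (c.measurable_enc u) i i.2
    have h1 : ∀ᵐ s ∂(serviceProcess ν), ENNReal.ofReal (departure (c.enc u) s (n - 1))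
        = ENNReal.ofReal (arrival (c.enc u) (fun _ => 0) 0) +
          ∑ i : Fin n, (ENNReal.ofReal (idle (c.enc u) s i) + ENNReal.ofReal (s i)) := by
      filter_upwards [ae_isServiceSeq hν] with s hs
      have hterm : ∀ i, 0 ≤ idle (c.enc u) s i + s i :=
        fun i => add_nonneg (idle_nonneg _ _ _) (hs i).1
      rw [departure_eq_sum, Nat.sub_add_cancel hn, arrival_zero (c.enc u) s (fun _ => 0),
        ENNReal.ofReal_add (c.arrival_nonneg u _ (isServiceSeq_zero 𝕋) 0 hn)
          (Finset.sum_nonneg fun i _ => hterm i),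
        ENNReal.ofReal_sum_of_nonneg fun i _ => hterm i, ← Fin.sum_univ_eq_sum_range
          (fun i => ENNReal.ofReal (idle (c.enc u) s i + s i))]
      congr 1
      refine Finset.sum_congr rfl fun i _ => ?_
      rw [ENNReal.ofReal_add (idle_nonneg _ _ _) (hs i).1]
    have h2 : ∀ i : Fin n, ∫⁻ s, ENNReal.ofReal (s (i : ℕ)) ∂(serviceProcess ν)
        = ENNReal.ofReal (1 / μ) := fun i => by
      rw [← hν.mean_eq, ← lintegral_map (f := fun x => ENNReal.ofReal x) (by fun_prop)
        (measurable_pi_apply (i : ℕ)), map_eval_serviceProcess ν i]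
    rw [lintegral_congr_ae h1, lintegral_add_left measurable_const, lintegral_finsetSum]
    · have h3 : ∀ i : Fin n, ∫⁻ s, (ENNReal.ofReal (idle (c.enc u) s i) + ENNReal.ofReal (s i))
          ∂(serviceProcess ν) = ∫⁻ s, ENNReal.ofReal (idle (c.enc u) s i) ∂(serviceProcess ν)
          + ENNReal.ofReal (1 / μ) := fun i => by
        rw [lintegral_add_left (hidle i).ennreal_ofReal, h2]
      simp_rw [h3, Finset.sum_add_distrib, hA]
      simp [add_assoc]
    · intro i _
      have := hidle i
      fun_prop
  rw [WeakFeedbackCode.meanLastDeparture] at hc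
  simp_rw [hdep] at hc
  rw [ENNReal.div_le_iff (by simpa using hM.ne') (by simp), Finset.sum_add_distrib,
    Finset.sum_const, Finset.card_univ, Fintype.card_fin, nsmul_eq_mul] at hc
  have hsplit : ENNReal.ofReal (n / lam) * M
      = M * (n * ENNReal.ofReal (1 / lam - 1 / μ)) + M * (n * ENNReal.ofReal (1 / μ)) := by
    rw [← mul_add, ← mul_add, ← ENNReal.ofReal_add ha (by positivity), sub_add_cancel,
      mul_comm, ← ENNReal.ofReal_natCast n, ← ENNReal.ofReal_mul (Nat.cast_nonneg n),
      mul_one_div]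
  rw [hsplit] at hc
  exact (ENNReal.add_le_add_iff_right (ENNReal.mul_ne_top (by simp)
    (ENNReal.mul_ne_top (by simp) ENNReal.ofReal_ne_top))).1 hc

theorem integral_nonneg_of_lintegral_exp_neg_le {α : Type*} [MeasurableSpace α] {m : Measure α}
    [IsProbabilityMeasure m] {Z : α → ℝ} (hZ : Integrable Z m)
    (h : ∫⁻ x, ENNReal.ofReal (Real.exp (-Z x)) ∂m ≤ 1) : 0 ≤ ∫ x, Z x ∂m := by
  have h1 : Integrable (fun x => 1 - Z x) m := (integrable_const _).sub hZ
  have h2 : ENNReal.ofReal (∫ x, (1 - Z x) ∂m) ≤ 1 := by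
    refine (ofReal_integral_le_lintegral h1).trans (le_trans (lintegral_mono fun x => ?_) h)
    exact ENNReal.ofReal_le_ofReal (by linarith [Real.add_one_le_exp (-Z x)])
  rw [ENNReal.ofReal_le_one, integral_sub (integrable_const _) hZ] at h2
  simp at h2
  exact h2

theorem exists_log_one_add_sq_le {δ : ℝ} (hδ : 0 < δ) :
    ∃ C : ℝ, ∀ w : ℝ, 0 ≤ w → Real.log (1 + w ^ 2) ≤ δ * w + C := by
  refine ⟨δ - 2 - 2 * Real.log (δ / 2), fun w hw => ?_⟩
  have h1 : Real.log (1 + w ^ 2) ≤ Real.log ((1 + w) ^ 2) :=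
    Real.log_le_log (by positivity) (by nlinarith)
  have h2 : Real.log (δ / 2 * (1 + w)) ≤ δ / 2 * (1 + w) - 1 :=
    Real.log_le_sub_one_of_pos (by positivity)
  rw [Real.log_mul (by positivity) (by positivity)] at h2
  rw [Real.log_pow] at h1
  push_cast at h1
  linarith

/-- The law of `lead`, for a packet and a message chosen uniformly at random. -/
def leadMixture {𝕋 : TimeModel} {n M : ℕ} (c : WeakFeedbackCode 𝕋 n M) (ν : Measure ℝ)
    [IsProbabilityMeasure ν] : Measure ℝ :=
  (M * n : ℝ≥0∞)⁻¹ • ∑ x : Fin M × Fin n,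
    (serviceProcess ν).map (fun s => lead (c.enc x.1) s x.2)

section LeadMixture

variable {𝕋 : TimeModel} {n M : ℕ} (c : WeakFeedbackCode 𝕋 n M)

theorem isProbabilityMeasure_map_lead (ν : Measure ℝ) [IsProbabilityMeasure ν]
    (x : Fin M × Fin n) :
    IsProbabilityMeasure ((serviceProcess ν).map (fun s => lead (c.enc x.1) s x.2)) :=
  Measure.isProbabilityMeasure_map (measurable_lead (c.measurable_enc x.1) x.2 x.2.2).aemeasurable

theorem natCast_mul_ne_zero {𝕋 : TimeModel} {n M : ℕ} (c : WeakFeedbackCode 𝕋 n M) :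
    (M * n : ℝ≥0∞) ≠ 0 := by
  have hn := c.n_pos
  have hM : 0 < M := (c.dec 0).pos
  simp [hn.ne', hM.ne']

theorem natCast_mul_ne_top (M n : ℕ) : (M * n : ℝ≥0∞) ≠ ⊤ := ENNReal.mul_ne_top (by simp) (by simp)

instance (ν : Measure ℝ) [IsProbabilityMeasure ν] : IsProbabilityMeasure (leadMixture c ν) := by
  have := isProbabilityMeasure_map_lead c ν
  refine ⟨?_⟩
  rw [leadMixture, Measure.smul_apply, Measure.finsetSum_apply]
  simp only [measure_univ, Finset.sum_const, Finset.card_univ, Fintype.card_prod, Fintype.card_fin,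
    nsmul_eq_mul, mul_one, smul_eq_mul, Nat.cast_mul]
  exact ENNReal.inv_mul_cancel (natCast_mul_ne_zero c) (natCast_mul_ne_top M n)

theorem ae_leadMixture_mem_instants {μ : ℝ} {ν : Measure ℝ} [IsProbabilityMeasure ν]
    (hν : IsServiceLaw 𝕋 μ ν) : ∀ᵐ x ∂(leadMixture c ν), x ∈ 𝕋.instants := by
  refine Measure.ae_smul_measure ?_ _
  rw [ae_iff, Measure.finsetSum_apply, Finset.sum_eq_zero]
  intro x _
  rw [← ae_iff, ae_map_iff (p := fun y => y ∈ 𝕋.instants)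
    (measurable_lead (c.measurable_enc x.1) x.2 x.2.2).aemeasurable (measurableSet_instants 𝕋)]
  filter_upwards [ae_isServiceSeq hν] with s hs
  exact lead_mem_instants c x.1 hs x.2 x.2.2

theorem jointLaw_leadMixture {μ : ℝ} {ν : Measure ℝ} [IsProbabilityMeasure ν]
    (hν : IsServiceLaw 𝕋 μ ν) :
    jointLaw (leadMixture c ν) ν = (M * n : ℝ≥0∞)⁻¹ • ∑ x : Fin M × Fin n,
      (serviceProcess ν).map (fun s => (idle (c.enc x.1) s x.2, idle (c.enc x.1) s x.2 + s x.2)) := by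
  have := isProbabilityMeasure_map_lead c ν
  have hp : IsProbabilityMeasure (leadMixture c ν) := inferInstance
  rw [leadMixture] at hp ⊢
  rw [jointLaw_smul_sum]
  congr 1
  refine Finset.sum_congr rfl fun x _ => ?_
  exact (map_idle_eq_jointLaw hν (c.measurable_enc x.1) x.2 x.2.2).symm

theorem map_idle_le_smul_jointLaw {μ : ℝ} {ν : Measure ℝ} [IsProbabilityMeasure ν]
    (hν : IsServiceLaw 𝕋 μ ν) (x : Fin M × Fin n) :
    (serviceProcess ν).map (fun s => (idle (c.enc x.1) s x.2, idle (c.enc x.1) s x.2 + s x.2))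
      ≤ (M * n : ℝ≥0∞) • jointLaw (leadMixture c ν) ν := by
  rw [jointLaw_leadMixture c hν, smul_smul,
    ENNReal.mul_inv_cancel (natCast_mul_ne_zero c) (natCast_mul_ne_top M n), one_smul]
  refine Measure.le_iff.2 fun A _ => ?_
  rw [Measure.finsetSum_apply]
  exact Finset.single_le_sum (f := fun x : Fin M × Fin n => (serviceProcess ν).map
    (fun s => (idle (c.enc x.1) s x.2, idle (c.enc x.1) s x.2 + s x.2)) A)
    (fun _ _ => zero_le) (Finset.mem_univ x)

theorem lintegral_leadMixture_le {μ lam : ℝ} (hlam : 0 < lam) (hlt : lam < μ)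
    {ν : Measure ℝ} [IsProbabilityMeasure ν] (hν : IsServiceLaw 𝕋 μ ν)
    (hc : c.meanLastDeparture ν ≤ ENNReal.ofReal (n / lam)) :
    ∫⁻ ω, ENNReal.ofReal (max (ω.1 - ω.2.1) 0) ∂((leadMixture c ν).prod (ν.prod ν))
      ≤ ENNReal.ofReal (1 / lam - 1 / μ) := by
  have h1 : ∫⁻ ω, ENNReal.ofReal (max (ω.1 - ω.2.1) 0) ∂((leadMixture c ν).prod (ν.prod ν))
      = ∫⁻ p, ENNReal.ofReal p.1 ∂(jointLaw (leadMixture c ν) ν) := by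
    rw [jointLaw, lintegral_map (by fun_prop) (by fun_prop)]
  have hpair : ∀ x : Fin M × Fin n,
      Measurable fun s : ℕ → ℝ => (idle (c.enc x.1) s x.2, idle (c.enc x.1) s x.2 + s x.2) :=
    fun x => by
      have := measurable_idle (c.measurable_enc x.1) x.2 x.2.2
      fun_prop
  rw [h1, jointLaw_leadMixture c hν, lintegral_smul_measure, lintegral_finsetSum_measure,
    smul_eq_mul]
  simp_rw [lintegral_map (f := fun p : ℝ × ℝ => ENNReal.ofReal p.1) (by fun_prop) (hpair _)]
  rw [Fintype.sum_prod_type, ENNReal.inv_mul_le_iff (natCast_mul_ne_zero c)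
    (natCast_mul_ne_top M n), mul_assoc]
  refine le_trans (Finset.sum_le_sum fun u _ => ?_) (sum_lintegral_idle_le hlam hlt hν c hc)
  exact le_add_self

end LeadMixture

/-! ### The converse -/

theorem sum_real_correct {𝕋 : TimeModel} {n M : ℕ} (c : WeakFeedbackCode 𝕋 n M)
    (ν : Measure ℝ) [IsProbabilityMeasure ν] {ε : ℝ≥0∞} (hε : ε ≠ ⊤) (hc : c.errorProb ν ≤ ε) :
    M * (1 - ε.toReal) ≤ ∑ u : Fin M, (serviceProcess ν).real
        {s | c.dec (fun i : Fin n => departure (c.enc u) s i) = u} := by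
  have hM : 0 < M := (c.dec 0).pos
  rw [WeakFeedbackCode.errorProb, ENNReal.div_le_iff (by simpa using hM.ne') (by simp)] at hc
  have h1 : ∑ u : Fin M, (serviceProcess ν).real
      {s | c.dec (fun i : Fin n => departure (c.enc u) s i) ≠ u} ≤ ε.toReal * M := by
    have := ENNReal.toReal_mono (ENNReal.mul_ne_top hε (by simp)) hc
    rw [ENNReal.toReal_sum (fun u _ => measure_ne_top _ _)] at this
    simpa [Measure.real] using this
  have h2 : ∀ u : Fin M, 1 - (serviceProcess ν).real
        {s | c.dec (fun i : Fin n => departure (c.enc u) s i) ≠ u}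
      ≤ (serviceProcess ν).real
        {s | c.dec (fun i : Fin n => departure (c.enc u) s i) = u} := fun u => by
    have hU : {s | c.dec (fun i : Fin n => departure (c.enc u) s i) = u}
        ∪ {s | c.dec (fun i : Fin n => departure (c.enc u) s i) ≠ u} = Set.univ := by
      ext s; simp [em]
    have := measureReal_union_le (μ := serviceProcess ν)
      {s | c.dec (fun i : Fin n => departure (c.enc u) s i) = u}
      {s | c.dec (fun i : Fin n => departure (c.enc u) s i) ≠ u}
    rw [hU, probReal_univ] at this
    linarith
  have h3 := Finset.sum_le_sum fun u (_ : u ∈ Finset.univ) => h2 u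
  rw [Finset.sum_sub_distrib] at h3
  simp only [Finset.sum_const, Finset.card_univ, Fintype.card_fin, nsmul_eq_mul, mul_one] at h3
  linarith

/-- Up to a term `C + n * δ` due to the first packet, `n` packets carry at most `n` times the
information supremum. The log-likelihood ratios of the packets `1, …, n - 1`, summed over the
packets and averaged over the messages, are at most `n` times the mutual information under the
average input law `leadMixture`, hence at most `n` times the supremum. -/
theorem exists_forall_log_card_le {𝕋 : TimeModel} {μ lam : ℝ} (hlam : 0 < lam) (hlt : lam < μ)
    (ν : Measure ℝ) [IsProbabilityMeasure ν] (hν : IsServiceLaw 𝕋 μ ν)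
    (hfin : infoSup 𝕋 ν (1 / lam - 1 / μ) ≠ ⊤) {δ : ℝ} (hδ : 0 < δ) :
    ∃ C : ℝ, ∀ (n M : ℕ) (ε : ℝ≥0∞) (c : WeakFeedbackCode 𝕋 n M), ε ≠ ⊤ →
      c.IsCode ν (n / lam) ε → (1 - ε.toReal) * Real.log M ≤
        C + n * (δ + (infoSup 𝕋 ν (1 / lam - 1 / μ)).toReal * Real.log 2) := by
  set a : ℝ := 1 / lam - 1 / μ with ha_def
  have ha : 0 < a := sub_pos.2 (one_div_lt_one_div_of_lt hlam hlt)
  obtain ⟨Q₁, ℓ, hQ₁, hℓm, hℓint, hfirst⟩ := exists_firstDepartureLaw ν hν ha hfin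
  obtain ⟨C, hC⟩ := exists_log_one_add_sq_le (div_pos hδ ha)
  refine ⟨C + ∫ s, ℓ s ∂ν + 2 * Q₁.real Set.univ, fun n M ε c hε hcode => ?_⟩
  have hn := c.n_pos
  have hM : 0 < M := (c.dec 0).pos
  have hM0 : (0 : ℝ) < M := by exact_mod_cast hM
  have hlog2 : 0 < Real.log 2 := Real.log_pos one_lt_two
  set P := serviceProcess ν with hP
  have hinfo := mutualInfo_le_infoSup 𝕋 ν a (leadMixture c ν) inferInstance
    (ae_leadMixture_mem_instants c hν) (lintegral_leadMixture_le c hlam hlt hν hcode.1)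
  obtain ⟨Q, g, hQ, hgm, hgint, hgI, hgood⟩ :=
    exists_logLikelihood (leadMixture c ν) ν (ne_top_of_le_ne_top hfin hinfo)
  have hidle : ∀ u, ∀ i < n, Measurable fun s => idle (c.enc u) s i :=
    fun u i hi => measurable_idle (c.measurable_enc u) i hi
  have hpair : ∀ u, ∀ i < n,
      Measurable fun s : ℕ → ℝ => (idle (c.enc u) s i, idle (c.enc u) s i + s i) :=
    fun u i hi => by
      have := hidle u i hi
      fun_prop
  -- Each packet and message has positive weight in `leadMixture`, so that what holds almost surely
  -- for the mixture holds for each of them.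
  have hnext : ∀ u, ∀ i < n, ∀ᵐ s ∂P, ∀ h : ℝ → ℝ≥0∞, Measurable h →
      ∫⁻ t, h (idle (c.enc u) s i + t) *
        ENNReal.ofReal (Real.exp (-g (idle (c.enc u) s i, idle (c.enc u) s i + t))) ∂ν
        ≤ ∫⁻ y, h y ∂Q := fun u i hi => by
    rw [← map_fst_jointLaw] at hgood
    have h1 := ae_of_ae_map measurable_fst.aemeasurable hgood
    have h2 := ae_mono (map_idle_le_smul_jointLaw c hν (u, ⟨i, hi⟩)) (Measure.ae_smul_measure h1 _)
    exact ae_of_ae_map (hpair u i hi).aemeasurable h2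
  have hgpair : ∀ u, ∀ i < n,
      Integrable (fun s => g (idle (c.enc u) s i, idle (c.enc u) s i + s i)) P := fun u i hi => by
    refine (integrable_map_measure hgm.aestronglyMeasurable (hpair u i hi).aemeasurable).1 ?_
    exact (hgint.smul_measure (natCast_mul_ne_top M n)).mono_measure
      (map_idle_le_smul_jointLaw c hν (u, ⟨i, hi⟩))
  have hgsum : ∑ u : Fin M, ∑ i : Fin n, ∫ s, g (idle (c.enc u) s i, idle (c.enc u) s i + s i) ∂P
      ≤ M * (n * ((infoSup 𝕋 ν a).toReal * Real.log 2)) := by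
    have h1 : ∫ p, g p ∂(jointLaw (leadMixture c ν) ν) = (M * n : ℝ)⁻¹ *
        ∑ u : Fin M, ∑ i : Fin n,
          ∫ s, g (idle (c.enc u) s i, idle (c.enc u) s i + s i) ∂P := by
      rw [jointLaw_leadMixture c hν, integral_smul_measure, integral_finsetSum_measure,
        Fintype.sum_prod_type]
      · simp_rw [integral_map (hpair _ _ (Fin.is_lt _)).aemeasurable hgm.aestronglyMeasurable]
        simp [hP]
      · intro x _
        exact (integrable_map_measure hgm.aestronglyMeasurable
          (hpair x.1 x.2 x.2.2).aemeasurable).2 (hgpair x.1 x.2 x.2.2)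
    have h2 : ∫ p, g p ∂(jointLaw (leadMixture c ν) ν)
        ≤ (infoSup 𝕋 ν a).toReal * Real.log 2 := by
      have h3 := hgI.le.trans (mul_le_mul' hinfo (le_refl (ENNReal.ofReal (Real.log 2))))
      rw [ENNReal.ofReal_le_iff_le_toReal (ENNReal.mul_ne_top hfin ENNReal.ofReal_ne_top),
        ENNReal.toReal_mul, ENNReal.toReal_ofReal hlog2.le] at h3
      exact h3
    rw [h1, inv_mul_le_iff₀ (by positivity)] at h2
    linarith
  -- The slot of the first packet in `leadMixture` contributes a relative entropy, which is
  -- nonnegative.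
  have hg0 : ∀ u : Fin M, 0 ≤ ∫ s, g (idle (c.enc u) s 0, idle (c.enc u) s 0 + s 0) ∂P := by
    intro u
    refine integral_nonneg_of_lintegral_exp_neg_le (hgpair u 0 hn) ?_
    obtain ⟨s₀, hs₀⟩ := (hnext u 0 hn).exists
    have h1 := hs₀ 1 measurable_one
    simp only [Pi.one_apply, one_mul, lintegral_const, measure_univ, mul_one, idle] at h1 ⊢
    rw [← map_eval_serviceProcess ν 0, lintegral_map (by fun_prop) (measurable_pi_apply 0)] at h1
    exact h1
  have hℓ0 : Integrable (fun s : ℕ → ℝ => ℓ (s 0)) P := by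
    refine (integrable_map_measure (f := fun s : ℕ → ℝ => s 0) ?_
      (measurable_pi_apply 0).aemeasurable).1 ?_
    · exact hℓm.aestronglyMeasurable
    · rw [hP, map_eval_serviceProcess ν 0]; exact hℓint
  have hsumint : ∀ u : Fin M, ∀ i ∈ Finset.range (n - 1), Integrable
      (fun s => g (idle (c.enc u) s (i + 1), idle (c.enc u) s (i + 1) + s (i + 1))) P :=
    fun u i hi => hgpair u (i + 1) (by rw [Finset.mem_range] at hi; omega)
  have hconst : ∀ u : Fin M, ∀ s : ℕ → ℝ,
      arrival (c.enc u) s 0 = arrival (c.enc u) (fun _ => 0) 0 := fun u s => arrival_zero _ _ _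
  have hA0 : ∀ u : Fin M, 0 ≤ arrival (c.enc u) (fun _ => 0) 0 :=
    fun u => c.arrival_nonneg u _ (isServiceSeq_zero 𝕋) 0 hn
  have hratio : ∀ u : Fin M, Integrable (fun s => logRatio ℓ g (c.enc u) s (n - 1)) P ∧
      ∫ s, logRatio ℓ g (c.enc u) s (n - 1) ∂P
        ≤ δ / a * arrival (c.enc u) (fun _ => 0) 0 + C + ∫ s, ℓ s ∂ν
          + ∑ i : Fin n, ∫ s, g (idle (c.enc u) s i, idle (c.enc u) s i + s i) ∂P := by
    intro u
    have hlast := integrable_finsetSum _ (hsumint u)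
    have hhead : Integrable (fun s : ℕ → ℝ =>
        Real.log (1 + arrival (c.enc u) (fun _ => 0) 0 ^ 2) + ℓ (s 0)) P :=
      (integrable_const _).add hℓ0
    simp only [logRatio, hconst]
    refine ⟨hhead.add hlast, ?_⟩
    rw [integral_add hhead hlast, integral_add (integrable_const _) hℓ0,
      integral_finsetSum _ (hsumint u), integral_const, probReal_univ, one_smul]
    have hℓeq : ∫ s : ℕ → ℝ, ℓ (s 0) ∂P = ∫ s, ℓ s ∂ν := by
      conv_rhs => rw [← map_eval_serviceProcess ν 0]
      rw [integral_map (measurable_pi_apply 0).aemeasurable hℓm.aestronglyMeasurable]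
    have hsplit := Fin.sum_univ_eq_sum_range
      (fun i => ∫ s, g (idle (c.enc u) s i, idle (c.enc u) s i + s i) ∂P) n
    obtain ⟨m, rfl⟩ : ∃ m, n = m + 1 := ⟨n - 1, by omega⟩
    rw [hsplit, Finset.sum_range_succ', hℓeq, Nat.add_sub_cancel]
    linarith [hC _ (hA0 u), hg0 u]
  have harr : ∑ u : Fin M, arrival (c.enc u) (fun _ => 0) 0 ≤ M * (n * a) := by
    have h1 := sum_lintegral_idle_le hlam hlt hν c hcode.1
    have h2 : ∑ u : Fin M, ENNReal.ofReal (arrival (c.enc u) (fun _ => 0) 0)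
        ≤ M * (n * ENNReal.ofReal a) :=
      (Finset.sum_le_sum fun u _ => le_self_add).trans h1
    rw [← ENNReal.ofReal_sum_of_nonneg fun u _ => hA0 u,
      ← ENNReal.ofReal_natCast n, ← ENNReal.ofReal_natCast M,
      ← ENNReal.ofReal_mul (Nat.cast_nonneg n), ← ENNReal.ofReal_mul hM0.le] at h2
    exact (ENNReal.ofReal_le_ofReal_iff (by positivity)).1 h2
  have hconv := log_mul_sum_correct_le c hℓm hgm (Q₁ := Q₁) (Q := Q)
    (fun u s => hfirst _ (by rw [hconst]; exact c.arrival_mem u _ (isServiceSeq_zero 𝕋) 0 hn))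
    hnext (fun u => (hratio u).1)
  have hcorrect := sum_real_correct c ν hε hcode.2
  have hsumratio := Finset.sum_le_sum fun u (_ : u ∈ Finset.univ) => (hratio u).2
  simp only [Finset.sum_add_distrib, ← Finset.mul_sum, Finset.sum_const, Finset.card_univ,
    Fintype.card_fin, nsmul_eq_mul] at hsumratio
  have hlogM : 0 ≤ Real.log M := Real.log_natCast_nonneg M
  have h1 := mul_le_mul_of_nonneg_left hcorrect hlogM
  have h2 : δ / a * ∑ u : Fin M, arrival (c.enc u) (fun _ => 0) 0 ≤ M * (n * δ) := by
    calc _ ≤ δ / a * (M * (n * a)) := by gcongr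
      _ = _ := by field_simp
  refine le_of_mul_le_mul_left ?_ hM0
  linarith

theorem rate_le_of_isAchievable {𝕋 : TimeModel} {μ lam : ℝ} (hlam : 0 < lam) (hlt : lam < μ)
    (ν : Measure ℝ) [IsProbabilityMeasure ν] (hν : IsServiceLaw 𝕋 μ ν)
    (hfin : infoSup 𝕋 ν (1 / lam - 1 / μ) ≠ ⊤) {R : ℝ} (hR : IsAchievable 𝕋 ν lam R) :
    R ≤ lam * (infoSup 𝕋 ν (1 / lam - 1 / μ)).toReal := by
  set F := (infoSup 𝕋 ν (1 / lam - 1 / μ)).toReal with hF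
  have hlog2 : 0 < Real.log 2 := Real.log_pos one_lt_two
  have key : ∀ γ > 0, ∀ δ > 0, R - γ ≤ lam / Real.log 2 * (δ + F * Real.log 2) := by
    intro γ hγ δ hδ
    obtain ⟨C, hC⟩ := exists_forall_log_card_le hlam hlt ν hν hfin hδ
    obtain ⟨n, M, ε, c, hn, hε, hc⟩ := hR γ hγ
    have hn' : Tendsto (fun k => (n k : ℝ)) atTop atTop :=
      tendsto_natCast_atTop_atTop.comp hn
    have hε' : Tendsto (fun k => (ε k).toReal) atTop (𝓝 0) :=
      (ENNReal.tendsto_toReal ENNReal.zero_ne_top).comp hε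
    have hleft : Tendsto (fun k => (1 - (ε k).toReal) * (R - γ)) atTop (𝓝 ((1 - 0) * (R - γ))) :=
      (tendsto_const_nhds.sub hε').mul tendsto_const_nhds
    have hright : Tendsto (fun k => lam / Real.log 2 * (C / n k + (δ + F * Real.log 2))) atTop
        (𝓝 (lam / Real.log 2 * (0 + (δ + F * Real.log 2)))) :=
      ((hn'.const_div_atTop C).add tendsto_const_nhds).const_mul _
    rw [sub_zero, one_mul] at hleft
    rw [zero_add] at hright
    refine le_of_tendsto_of_tendsto hleft hright ?_
    filter_upwards [hε.eventually_lt_const (show (0 : ℝ≥0∞) < 1 by simp)] with k hk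
    have hnk : (0 : ℝ) < n k := by exact_mod_cast (c k).n_pos
    have hbound := hC (n k) (M k) (ε k) (c k) (hk.trans ENNReal.one_lt_top).ne (hc k).1
    have hone : 0 ≤ 1 - (ε k).toReal := by
      have := ENNReal.toReal_mono ENNReal.one_ne_top hk.le
      simp only [ENNReal.toReal_one] at this
      linarith
    calc (1 - (ε k).toReal) * (R - γ)
        ≤ (1 - (ε k).toReal) * (lam * (Real.logb 2 (M k) / n k)) :=
          mul_le_mul_of_nonneg_left (hc k).2.le hone
      _ = lam / Real.log 2 / n k * ((1 - (ε k).toReal) * Real.log (M k)) := by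
          rw [Real.logb]; field_simp
      _ ≤ lam / Real.log 2 / n k * (C + n k * (δ + F * Real.log 2)) := by gcongr
      _ = _ := by field_simp
  have key2 : ∀ γ > 0, R - γ ≤ lam * F := by
    intro γ hγ
    refine le_of_forall_pos_le_add fun η hη => ?_
    have := key γ hγ (η * Real.log 2 / lam) (by positivity)
    calc R - γ ≤ _ := this
      _ = lam * F + η := by field_simp; ring
  exact le_of_forall_pos_le_add fun γ hγ => by linarith [key2 γ hγ]

end TimingChannel
end

theorem theorem3p3 (𝕋 : TimingChannel.TimeModel) (μ lam : ℝ) (hlam : 0 < lam) (hlt : lam < μ)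
    (ν : MeasureTheory.Measure ℝ) [MeasureTheory.IsProbabilityMeasure ν]
    (hν : TimingChannel.IsServiceLaw 𝕋 μ ν) :
    TimingChannel.weakFeedbackCapacity 𝕋 ν lam ≤
      ENNReal.ofReal lam * TimingChannel.infoSup 𝕋 ν (1 / lam - 1 / μ) := by
  by_cases hfin : TimingChannel.infoSup 𝕋 ν (1 / lam - 1 / μ) = ⊤
  · rw [hfin, ENNReal.mul_top (by simpa using hlam)]
    exact le_top
  · refine iSup₂_le fun R hR => ?_
    have h := TimingChannel.rate_le_of_isAchievable hlam hlt ν hν hfin hR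
    rw [← ENNReal.ofReal_coe_nnreal, ← ENNReal.ofReal_toReal hfin, ← ENNReal.ofReal_mul hlam.le]
    exact ENNReal.ofReal_le_ofReal h
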